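/- Let $\mathfrak h$ be a separable complex Hilbert space with a complex conjugation $\mathcal C$, i.e. an antilinear map $\mathcal C:\mathfrak h\to\mathfrak h$ with $\mathcal C^2=\mathbf 1$ and $\langle \mathcal Cf,\mathcal Cg\rangle=\langle g,f\rangle$ for all $f,g\in\mathfrak h$. For a densely defined operator $X$ on $\mathfrak h$ with domain $\mathcal D(X)$, let $X^\top=\mathcal C X^*\mathcal C$ denote its transpose, with domain $\mathcal D(X^\top)=\{f:\mathcal Cf\in\mathcal D(X^*)\}$. Write $\mathcal B(\mathfrak h)$ for the bounded operators on $\mathfrak h$ with the operator norm and $\mathcal B(\mathfrak h)^+$ for the positive ones. **Theorem (Well-posedness of the flow, strong topology).** Let $\mu\in\mathbb R$, let $\Upsilon_0=\Upsilon_0^*$ be a (possibly unbounded) self-adjoint operator on $\mathfrak h$ with $\Upsilon_0\ge-\mu\mathbf 1$, and let $D_0\in\mathcal B(\mathfrak h)$, $D_0\ne0$. Then there is a unique pair of strongly continuous maps $\Delta=(\Delta_t)_{t\ge0}$ and $D=(D_t)_{t\ge0}$ from $[0,\infty)$ to $\mathcal B(\mathfrak h)$ solving the initial value problem $$\partial_t\Delta_t\varphi=16\,D_tD_t^*\varphi,\qquad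 \Delta_{t=0}=0,\qquad t\in[0,\infty),\ \varphi\in\mathfrak h,$$ $$\partial_tD_t\varphi=-2\big((\Delta_t+\Upsilon_0)D_t+D_t(\Delta_t+\Upsilon_0)^\top\big)\varphi,\qquad D_{t=0}=D_0,\qquad t\in(0,\infty),\ \varphi\in\mathcal D(\Upsilon_0^\top),$$ where derivatives are taken in the norm of $\mathfrak h$ (one-sided at $t=0$), and the second equation includes the requirement that its right-hand side is defined, i.e. $D_t\varphi\in\mathcal D(\Upsilon_0)$ for all $t>0$ and $\varphi\in\mathcal D(\Upsilon_0^\top)$. Moreover: (i) $\Delta\in C([0,\infty);\mathcal B(\mathfrak h)^+)$, and $\Delta$ is locally Lipschitz continuous in the operator norm on $[0,\infty)$; (ii) $(D_t)_{t>0}\in C((0,\infty);\mathcal B(\mathfrak h))$ is locally Lipschitz continuous in the operator norm, and $D_t\mathfrak h\subseteq\mathcal D(\Upsilon_0)$ for every $t>0$. -/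

import Mathlib

open Set Topology
open scoped InnerProductSpace

/-- A complex conjugation on a complex Hilbert space: an antiunitary involution, i.e. an antilinear
map `C` with `C (C f) = f` and `⟪C f, C g⟫ = ⟪g, f⟫`. -/
structure ComplexConjugation (H : Type*) [NormedAddCommGroup H] [InnerProductSpace ℂ H] where
  /-- The underlying antilinear map. -/
  toFun : H →ₛₗ[starRingEnd ℂ] H
  involutive : ∀ f : H, toFun (toFun f) = f
  inner_map_map : ∀ f g : H, ⟪toFun f, toFun g⟫_ℂ = ⟪g, f⟫_ℂ

namespace ComplexConjugation

variable {H : Type*} [NormedAddCommGroup H] [InnerProductSpace ℂ H]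

/-- The complex conjugate `C X C` of a (possibly unbounded) operator `X`, with its natural domain
`{f | C f ∈ D(X)}`. -/
def conj (C : ComplexConjugation H) (X : H →ₗ.[ℂ] H) : H →ₗ.[ℂ] H where
  domain := X.domain.comap C.toFun
  toFun :=
    { toFun := fun f => C.toFun (X ⟨C.toFun f, f.2⟩)
      map_add' := fun f g => by
        rw [← map_add, ← LinearPMap.map_add]
        congr 2
        exact Subtype.ext (map_add C.toFun (f : H) (g : H))
      map_smul' := fun c f => by
        have h : (⟨C.toFun ((c • f : X.domain.comap C.toFun) : H), (c • f).2⟩ : X.domain)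
            = (starRingEnd ℂ c) • ⟨C.toFun f, f.2⟩ :=
          Subtype.ext (C.toFun.map_smulₛₗ c (f : H))
        rw [h, LinearPMap.map_smul, LinearMap.map_smulₛₗ]
        simp }

variable [CompleteSpace H]

/-- The transpose `Xᵀ = C X* C` of a (possibly unbounded, densely defined) operator `X`, with its
natural domain `{f | C f ∈ D(X*)}`. -/
noncomputable def transpose (C : ComplexConjugation H) (X : H →ₗ.[ℂ] H) : H →ₗ.[ℂ] H :=
  C.conj X.adjoint

end ComplexConjugation

section Flow

variable {H : Type*} [NormedAddCommGroup H] [InnerProductSpace ℂ H]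

/-- `X ≥ c 𝟏` in the sense of quadratic forms on the domain of `X`. -/
def LowerBoundedBy (X : H →ₗ.[ℂ] H) (c : ℝ) : Prop :=
  ∀ f : X.domain, c * ‖(f : H)‖ ^ 2 ≤ (⟪(f : H), X f⟫_ℂ).re

/-- The operator `Δ + Υ₀`, for bounded `Δ`, with domain `D(Υ₀)`. -/
def addBounded (Δ : H →L[ℂ] H) (Υ₀ : H →ₗ.[ℂ] H) : H →ₗ.[ℂ] H :=
  (Δ : H →ₗ[ℂ] H) +ᵥ Υ₀

/-- A family of bounded operators indexed by `t ≥ 0` (values at `t < 0` are irrelevant) that is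
continuous on `[0, ∞)` for the strong operator topology. -/
def StronglyContinuous (X : ℝ → H →L[ℂ] H) : Prop :=
  ∀ φ : H, ContinuousOn (fun t => X t φ) (Ici 0)

/-- `(Δ, D)` is a strongly continuous solution on `[0, ∞)` of the initial value problem
`∂ₜ Δₜ φ = 16 Dₜ Dₜ* φ` for `t ≥ 0`, `φ ∈ H`, with `Δ₀ = 0`, and
`∂ₜ Dₜ φ = -2 ((Δₜ + Υ₀) Dₜ + Dₜ (Δₜ + Υ₀)ᵀ) φ` for `t > 0`, `φ ∈ D(Υ₀ᵀ)`, with value `D₀` at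
`t = 0`. The second equation includes that its right-hand side makes sense, i.e. that `Dₜ φ` and
`φ` lie in the domains of `Δₜ + Υ₀` and `(Δₜ + Υ₀)ᵀ`. The derivative of `Δ` at `t = 0` is
one-sided. -/
structure IsFlowSolution [CompleteSpace H] (C : ComplexConjugation H) (Υ₀ : H →ₗ.[ℂ] H)
    (D₀ : H →L[ℂ] H) (Δ D : ℝ → H →L[ℂ] H) : Prop where
  continuous_delta : StronglyContinuous Δ
  continuous_D : StronglyContinuous D
  delta_zero : Δ 0 = 0
  D_zero : D 0 = D₀
  deriv_delta : ∀ t : ℝ, 0 ≤ t → ∀ φ : H,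
    HasDerivWithinAt (fun s => Δ s φ) ((16 : ℝ) • D t (ContinuousLinearMap.adjoint (D t) φ))
      (Ici 0) t
  deriv_D : ∀ t : ℝ, 0 < t → ∀ φ ∈ (C.transpose Υ₀).domain,
    ∃ (h₁ : D t φ ∈ (addBounded (Δ t) Υ₀).domain)
      (h₂ : φ ∈ (C.transpose (addBounded (Δ t) Υ₀)).domain),
      HasDerivAt (fun s => D s φ)
        ((-2 : ℝ) • (addBounded (Δ t) Υ₀ ⟨D t φ, h₁⟩
          + D t (C.transpose (addBounded (Δ t) Υ₀) ⟨φ, h₂⟩))) t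

end Flow

/-- The function `x ↦ (1/x - 1) ^ n * exp (-2 t (1/x - 1))` for `x > 0`, extended by zero. -/
noncomputable def heatSymbol (n : ℕ) (t x : ℝ) : ℝ :=
  (x⁻¹ - 1) ^ n * (Real.exp (2 * t) * expNegInvGlue (x / (2 * t)))

theorem heatSymbol_zero (n : ℕ) (t : ℝ) : heatSymbol n t 0 = 0 := by
  simp [heatSymbol, expNegInvGlue.zero_of_nonpos]

theorem heatSymbol_of_pos (n : ℕ) {t x : ℝ} (ht : 0 < t) (hx : 0 < x) :
    heatSymbol n t x = (x⁻¹ - 1) ^ n * Real.exp (-(2 * t * (x⁻¹ - 1))) := by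
  have h : ¬ x / (2 * t) ≤ 0 := not_le.2 (by positivity)
  rw [heatSymbol, expNegInvGlue, if_neg h, ← Real.exp_add]
  congr 2
  field_simp
  ring

theorem continuous_heatSymbol (n : ℕ) {t : ℝ} (ht : 0 < t) : Continuous (heatSymbol n t) := by
  have h := (expNegInvGlue.continuous_polynomial_eval_inv_mul
    ((Polynomial.C (2 * t)⁻¹ * Polynomial.X - 1) ^ n)).comp
    (continuous_id.div_const (2 * t))
  convert h.const_mul (Real.exp (2 * t)) using 1
  funext x
  simp only [heatSymbol, Function.comp, id, Polynomial.eval_pow, Polynomial.eval_sub,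
    Polynomial.eval_mul, Polynomial.eval_C, Polynomial.eval_X, Polynomial.eval_one]
  have : (2 * t)⁻¹ * (x / (2 * t))⁻¹ = x⁻¹ := by
    rw [inv_div]; field_simp
  rw [this]; ring

theorem exp_sub_one_sub_le (y : ℝ) : |Real.exp y - 1 - y| ≤ y ^ 2 * Real.exp |y| := by
  have h := Complex.norm_exp_sub_sum_le_norm_mul_exp (y : ℂ) 2
  simp only [Finset.sum_range_succ, Finset.sum_range_zero, Nat.factorial, pow_zero, pow_one,
    zero_add, mul_one, Nat.cast_one, div_one] at h
  rw [show Complex.exp y - (1 + (y : ℂ)) = ((Real.exp y - 1 - y : ℝ) : ℂ) by push_cast; ring,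
    Complex.norm_real, Complex.norm_real, Real.norm_eq_abs, Real.norm_eq_abs, sq_abs] at h
  exact h

theorem pow_mul_exp_neg_le (n : ℕ) {t b : ℝ} (ht : 0 < t) (hb : 0 ≤ b) :
    b ^ n * Real.exp (-(t * b)) ≤ n.factorial / t ^ n := by
  have h := Real.pow_div_factorial_le_exp (t * b) (by positivity) n
  have hf : (0 : ℝ) < n.factorial := by positivity
  rw [Real.exp_neg, ← div_eq_mul_inv, div_le_div_iff₀ (Real.exp_pos _) (by positivity)]
  rw [div_le_iff₀ hf, mul_pow] at h
  linarith

theorem abs_heatSymbol_le (n : ℕ) {t x : ℝ} (ht : 0 < t) (hx : x ∈ Icc (0 : ℝ) 1) :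
    |heatSymbol n t x| ≤ n.factorial / (2 * t) ^ n := by
  rcases hx.1.eq_or_lt with rfl | hx0
  · rw [heatSymbol_zero, abs_zero]; positivity
  have hb : 0 ≤ x⁻¹ - 1 := sub_nonneg.2 ((one_le_inv₀ hx0).2 hx.2)
  rw [heatSymbol_of_pos n ht hx0, abs_of_nonneg (by positivity)]
  exact pow_mul_exp_neg_le n (by positivity) hb

theorem abs_heatSymbol_taylor_le (n : ℕ) {t h x : ℝ} (ht : 0 < t) (hh : |h| ≤ t / 2)
    (hx : x ∈ Icc (0 : ℝ) 1) :
    |heatSymbol n (t + h) x - heatSymbol n t x - h * (-2 * heatSymbol (n + 1) t x)|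
      ≤ 4 * (n + 2).factorial / t ^ (n + 2) * h ^ 2 := by
  rcases hx.1.eq_or_lt with rfl | hx0
  · simp only [heatSymbol_zero, mul_zero, sub_zero, abs_zero]; positivity
  have hb : 0 ≤ x⁻¹ - 1 := sub_nonneg.2 ((one_le_inv₀ hx0).2 hx.2)
  have hth : 0 < t + h := by linarith [neg_abs_le h]
  rw [heatSymbol_of_pos _ hth hx0, heatSymbol_of_pos _ ht hx0, heatSymbol_of_pos _ ht hx0]
  set b := x⁻¹ - 1
  have e1 : b ^ n * Real.exp (-(2 * (t + h) * b)) - b ^ n * Real.exp (-(2 * t * b))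
      - h * (-2 * (b ^ (n + 1) * Real.exp (-(2 * t * b))))
      = b ^ n * Real.exp (-(2 * t * b)) * (Real.exp (-(2 * h * b)) - 1 - -(2 * h * b)) := by
    rw [show -(2 * (t + h) * b) = -(2 * t * b) + -(2 * h * b) by ring, Real.exp_add]
    ring
  rw [e1, abs_mul, abs_of_nonneg (by positivity)]
  have e2 : Real.exp |-(2 * h * b)| ≤ Real.exp (t * b) := by
    apply Real.exp_le_exp.2
    rw [abs_neg, abs_mul, abs_mul, abs_of_nonneg hb, abs_two]
    nlinarith
  calc b ^ n * Real.exp (-(2 * t * b)) * |Real.exp (-(2 * h * b)) - 1 - -(2 * h * b)|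
      ≤ b ^ n * Real.exp (-(2 * t * b)) * ((-(2 * h * b)) ^ 2 * Real.exp (t * b)) := by
        gcongr
        exact (exp_sub_one_sub_le _).trans (by gcongr)
    _ = 4 * (b ^ (n + 2) * Real.exp (-(t * b))) * h ^ 2 := by
        rw [show -(t * b) = -(2 * t * b) + t * b by ring, Real.exp_add]
        ring
    _ ≤ 4 * ((n + 2).factorial / t ^ (n + 2)) * h ^ 2 := by
        gcongr
        exact pow_mul_exp_neg_le (n + 2) ht hb
    _ = _ := by ring

section CFC

variable {𝓐 : Type*} [CStarAlgebra 𝓐]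

/-- `Bⁿ e^{-2tB}`, where `R = (B + 1)⁻¹`. -/
noncomputable def heatOp (R : 𝓐) (n : ℕ) (t : ℝ) : 𝓐 := cfc (heatSymbol n t) R

variable {R : 𝓐}

theorem isSelfAdjoint_heatOp (n : ℕ) (t : ℝ) : IsSelfAdjoint (heatOp R n t) := cfc_predicate _ _

theorem commute_heatOp (hR : IsSelfAdjoint R) (n : ℕ) (t : ℝ) : Commute R (heatOp R n t) := by
  have := cfc_commute_cfc (id : ℝ → ℝ) (heatSymbol n t) R
  rwa [cfc_id ℝ R hR] at this

theorem norm_heatOp_le (hs : spectrum ℝ R ⊆ Icc 0 1) (n : ℕ) {t : ℝ} (ht : 0 < t) :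
    ‖heatOp R n t‖ ≤ n.factorial / (2 * t) ^ n :=
  norm_cfc_le (by positivity) fun x hx => abs_heatSymbol_le n ht (hs hx)

theorem hasDerivAt_heatOp (hs : spectrum ℝ R ⊆ Icc 0 1) (n : ℕ) {t : ℝ} (ht : 0 < t) :
    HasDerivAt (heatOp R n) ((-2 : ℝ) • heatOp R (n + 1) t) t := by
  rw [hasDerivAt_iff_isLittleO_nhds_zero]
  have hO : (fun h => heatOp R n (t + h) - heatOp R n t - h • (-2 : ℝ) • heatOp R (n + 1) t)
      =O[𝓝 0] fun h : ℝ => h ^ 2 := by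
    refine Asymptotics.IsBigO.of_bound (4 * (n + 2).factorial / t ^ (n + 2)) ?_
    filter_upwards [Metric.closedBall_mem_nhds (0 : ℝ) (half_pos ht)] with h hh
    have hh' : |h| ≤ t / 2 := by simpa using hh
    have hth : 0 < t + h := by linarith [neg_abs_le h]
    have c0 := (continuous_heatSymbol n hth).continuousOn (s := spectrum ℝ R)
    have c1 := (continuous_heatSymbol n ht).continuousOn (s := spectrum ℝ R)
    have c2 := (continuous_heatSymbol (n + 1) ht).continuousOn (s := spectrum ℝ R)
    have e : heatOp R n (t + h) - heatOp R n t - h • (-2 : ℝ) • heatOp R (n + 1) t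
        = cfc (fun x => heatSymbol n (t + h) x - heatSymbol n t x
          - h * (-2 * heatSymbol (n + 1) t x)) R := by
      rw [cfc_sub (fun x => heatSymbol n (t + h) x - heatSymbol n t x)
          (fun x => h * (-2 * heatSymbol (n + 1) t x)) R (c0.sub c1)
          (continuousOn_const.mul (continuousOn_const.mul c2)),
        cfc_sub _ _ R c0 c1, cfc_const_mul h (fun x => -2 * heatSymbol (n + 1) t x) R
          (continuousOn_const.mul c2), cfc_const_mul _ _ R c2]
      rfl
    rw [e, Real.norm_of_nonneg (sq_nonneg h)]
    exact norm_cfc_le (by positivity) fun x hx => abs_heatSymbol_taylor_le n ht hh' (hs hx)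
  exact hO.trans_isLittleO (by
    simpa using Asymptotics.isLittleO_pow_pow (𝕜 := ℝ) (one_lt_two : 1 < 2))

theorem mul_heatOp_one (hs : spectrum ℝ R ⊆ Icc 0 1) (hR : IsSelfAdjoint R)
    {t : ℝ} (ht : 0 < t) :
    R * heatOp R 1 t = (1 - R) * heatOp R 0 t := by
  have c0 := (continuous_heatSymbol 0 ht).continuousOn (s := spectrum ℝ R)
  have c1 := (continuous_heatSymbol 1 ht).continuousOn (s := spectrum ℝ R)
  have hid : R = cfc (id : ℝ → ℝ) R := (cfc_id ℝ R hR).symm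
  have e1 : R * heatOp R 1 t = cfc (fun x => id x * heatSymbol 1 t x) R := by
    rw [cfc_mul _ _ R continuousOn_id c1, ← hid]; rfl
  have e2 : (1 - R) * heatOp R 0 t = cfc (fun x => heatSymbol 0 t x - id x * heatSymbol 0 t x) R := by
    rw [cfc_sub _ (fun x => id x * heatSymbol 0 t x) R c0 (continuousOn_id.mul c0), cfc_mul _ _ R continuousOn_id c0, ← hid,
      sub_mul, one_mul]; rfl
  rw [e1, e2]
  refine cfc_congr fun x hx => ?_
  rcases (hs hx).1.eq_or_lt with rfl | hx0
  · simp [heatSymbol_zero]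
  · simp only [heatSymbol, id]
    field_simp

theorem norm_mul_heatOp_sub_le (hs : spectrum ℝ R ⊆ Icc 0 1) (hR : IsSelfAdjoint R)
    {t : ℝ} (ht : 0 < t) : ‖R * heatOp R 0 t - R‖ ≤ 2 * t := by
  have c0 := (continuous_heatSymbol 0 ht).continuousOn (s := spectrum ℝ R)
  have hid : R = cfc (id : ℝ → ℝ) R := (cfc_id ℝ R hR).symm
  have e1 : R * heatOp R 0 t - R = cfc (fun x => id x * heatSymbol 0 t x - id x) R := by
    rw [cfc_sub (fun x => id x * heatSymbol 0 t x) _ R (continuousOn_id.mul c0) continuousOn_id,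
      cfc_mul _ _ R continuousOn_id c0, ← hid]; rfl
  rw [e1]
  refine norm_cfc_le (by positivity) fun x hx => ?_
  obtain ⟨h0, h1⟩ := hs hx
  rcases h0.eq_or_lt with rfl | hx0
  · simp [ht.le]
  have hb : 0 ≤ x⁻¹ - 1 := sub_nonneg.2 ((one_le_inv₀ hx0).2 h1)
  rw [heatSymbol_of_pos 0 ht hx0, pow_zero, one_mul, id, Real.norm_eq_abs]
  have l1 := Real.add_one_le_exp (-(2 * t * (x⁻¹ - 1)))
  have l2 : Real.exp (-(2 * t * (x⁻¹ - 1))) ≤ 1 := Real.exp_le_one_iff.2 (by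
    have := mul_nonneg ht.le hb; linarith)
  rw [abs_le]
  have hx1 : x * (x⁻¹ - 1) = 1 - x := by field_simp
  constructor
  · nlinarith [mul_le_mul_of_nonneg_left l1 hx0.le, mul_nonneg ht.le hx0.le]
  · nlinarith [mul_le_mul_of_nonneg_left l2 hx0.le]

end CFC

/-- `P t = e^{-2tB}` and `K t = B e^{-2tB}` for a nonnegative `B` with `R = (B + 1)⁻¹`, described by
their norm regularity for `t > 0` in a normed algebra. -/
structure IsHeatSemigroup {𝓐 : Type*} [NormedRing 𝓐] [NormedAlgebra ℝ 𝓐] (R : 𝓐) (P K : ℝ → 𝓐) :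
    Prop where
  zero : P 0 = 1
  norm_le : ∀ t, 0 < t → ‖P t‖ ≤ 1
  hasDerivAt : ∀ t, 0 < t → HasDerivAt P ((-2 : ℝ) • K t) t
  norm_gen_le : ∀ t, 0 < t → ‖K t‖ ≤ 1 / t
  continuousAt_gen : ∀ t, 0 < t → ContinuousAt K t
  mul_gen : ∀ t, 0 < t → R * K t = (1 - R) * P t
  norm_mul_sub_le : ∀ t, 0 < t → ‖R * P t - R‖ ≤ 2 * t
  cancel : ∀ x, R * x = 0 → x = 0

/-- The semigroup `e^{-2tB}`, extended by the identity to `t ≤ 0`, where `R = (B + 1)⁻¹`. -/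
noncomputable def heat {𝓐 : Type*} [CStarAlgebra 𝓐] (R : 𝓐) (t : ℝ) : 𝓐 :=
  if 0 < t then heatOp R 0 t else 1

theorem heat_of_pos {𝓐 : Type*} [CStarAlgebra 𝓐] (R : 𝓐) {t : ℝ} (ht : 0 < t) :
    heat R t = heatOp R 0 t := if_pos ht

theorem isHeatSemigroup_heat {𝓐 : Type*} [CStarAlgebra 𝓐] {R : 𝓐} (hs : spectrum ℝ R ⊆ Icc 0 1)
    (hR : IsSelfAdjoint R) (hc : ∀ x, R * x = 0 → x = 0) :
    IsHeatSemigroup R (heat R) (heatOp R 1) where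
  zero := if_neg (lt_irrefl 0)
  norm_le t ht := by simpa [heat_of_pos R ht] using norm_heatOp_le hs 0 ht
  hasDerivAt t ht := (hasDerivAt_heatOp hs 0 ht).congr_of_eventuallyEq (by
    filter_upwards [lt_mem_nhds ht] with s h using heat_of_pos R h)
  norm_gen_le t ht := (norm_heatOp_le hs 1 ht).trans (by
    simp only [Nat.factorial, pow_one]
    gcongr <;> [norm_num; linarith])
  continuousAt_gen t ht := (hasDerivAt_heatOp hs 1 ht).continuousAt
  mul_gen t ht := by rw [heat_of_pos R ht, mul_heatOp_one hs hR ht]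
  norm_mul_sub_le t ht := by rw [heat_of_pos R ht]; exact norm_mul_heatOp_sub_le hs hR ht
  cancel := hc

theorem isSelfAdjoint_heat {𝓐 : Type*} [CStarAlgebra 𝓐] (R : 𝓐) (t : ℝ) :
    IsSelfAdjoint (heat R t) := by
  unfold heat
  split_ifs
  exacts [isSelfAdjoint_heatOp 0 t, IsSelfAdjoint.one _]

theorem commute_heat {𝓐 : Type*} [CStarAlgebra 𝓐] {R : 𝓐} (hR : IsSelfAdjoint R) (t : ℝ) :
    Commute R (heat R t) := by
  unfold heat
  split_ifs
  exacts [commute_heatOp hR 0 t, Commute.one_right _]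

section FlowTheory

open MeasureTheory

section IntervalIntegral

variable {E : Type*} [NormedAddCommGroup E]

theorem intervalIntegrable_of_continuousOn_of_norm_le {f : ℝ → E} {g : ℝ → ℝ} {a b : ℝ}
    (hab : a ≤ b) (hf : ContinuousOn f (Ioo a b)) (hg : IntervalIntegrable g volume a b)
    (h : ∀ x ∈ Ioo a b, ‖f x‖ ≤ g x) : IntervalIntegrable f volume a b := by
  rw [intervalIntegrable_iff_integrableOn_Ioo_of_le hab] at hg ⊢
  exact hg.mono' (hf.aestronglyMeasurable measurableSet_Ioo)
    (ae_restrict_of_forall_mem measurableSet_Ioo h)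

theorem norm_intervalIntegral_le_of_norm_le_Ioo [NormedSpace ℝ E] {f : ℝ → E} {g : ℝ → ℝ}
    {a b : ℝ} (hab : a ≤ b) (hg : IntervalIntegrable g volume a b)
    (h : ∀ x ∈ Ioo a b, ‖f x‖ ≤ g x) : ‖∫ x in a..b, f x‖ ≤ ∫ x in a..b, g x := by
  refine intervalIntegral.norm_integral_le_of_norm_le hab ?_ hg
  have : ∀ᵐ x : ℝ, x ≠ b := by simp [ae_iff]
  filter_upwards [this] with x hx hx'
  exact h x ⟨hx'.1, lt_of_le_of_ne hx'.2 hx⟩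

theorem norm_intervalIntegral_le_const_Ioo [NormedSpace ℝ E] {f : ℝ → E} {M : ℝ}
    {a b : ℝ} (hab : a ≤ b) (h : ∀ x ∈ Ioo a b, ‖f x‖ ≤ M) :
    ‖∫ x in a..b, f x‖ ≤ M * (b - a) := by
  have := norm_intervalIntegral_le_of_norm_le_Ioo (g := fun _ => M) hab
    intervalIntegrable_const h
  simpa [mul_comm] using this

theorem intervalIntegral_congr_Ioo [NormedSpace ℝ E] {f g : ℝ → E} {a b : ℝ} (hab : a ≤ b)
    (h : ∀ x ∈ Ioo a b, f x = g x) : ∫ x in a..b, f x = ∫ x in a..b, g x := by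
  rw [intervalIntegral.integral_of_le hab, intervalIntegral.integral_of_le hab,
    integral_Ioc_eq_integral_Ioo, integral_Ioc_eq_integral_Ioo]
  exact setIntegral_congr_fun measurableSet_Ioo h

theorem intervalIntegrable_sub_rpow (t : ℝ) :
    IntervalIntegrable (fun s => (t - s) ^ (-(1 / 2) : ℝ)) volume 0 t := by
  have := (intervalIntegral.intervalIntegrable_rpow' (a := 0) (b := t)
    (r := (-(1 / 2) : ℝ)) (by norm_num)).comp_sub_left t
  simpa using this.symm

theorem integral_sub_rpow (t : ℝ) :
    ∫ s in (0 : ℝ)..t, (t - s) ^ (-(1 / 2) : ℝ) = 2 * √t := by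
  rw [intervalIntegral.integral_comp_sub_left (fun x => x ^ (-(1 / 2) : ℝ)) t, sub_self, sub_zero,
    integral_rpow (Or.inl (by norm_num)), Real.sqrt_eq_rpow,
    Real.zero_rpow (by norm_num)]
  norm_num
  ring

end IntervalIntegral

section Convolution

variable {𝓐 : Type*} [NormedRing 𝓐] [NormedAlgebra ℝ 𝓐] {R : 𝓐} {P K : ℝ → 𝓐}

theorem IsHeatSemigroup.continuousOn (hP : IsHeatSemigroup R P K) : ContinuousOn P (Ioi 0) :=
  fun t ht => (hP.hasDerivAt t ht).continuousAt.continuousWithinAt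

theorem IsHeatSemigroup.continuousOn_gen (hP : IsHeatSemigroup R P K) : ContinuousOn K (Ioi 0) :=
  fun t ht => (hP.continuousAt_gen t ht).continuousWithinAt

theorem IsHeatSemigroup.norm_sub_le (hP : IsHeatSemigroup R P K) {s t : ℝ} (hs : 0 < s)
    (hst : s ≤ t) : ‖P t - P s‖ ≤ 2 * √(t - s) * s ^ (-(1 / 2) : ℝ) := by
  have h1 : ‖P t - P s‖ ≤ 2 / s * ‖t - s‖ := by
    refine Convex.norm_image_sub_le_of_norm_hasDerivWithin_le
      (f' := fun r => (-2 : ℝ) • K r) (s := Ici s)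
      (fun r hr => (hP.hasDerivAt r (hs.trans_le hr)).hasDerivWithinAt) (fun r hr => ?_)
      (convex_Ici s) self_mem_Ici hst
    have hr0 : 0 < r := hs.trans_le hr
    rw [norm_smul, Real.norm_eq_abs, abs_neg, abs_two, div_eq_mul_one_div]
    have := (hP.norm_gen_le r hr0).trans (one_div_le_one_div_of_le hs hr)
    gcongr
  have h2 : ‖P t - P s‖ ≤ 2 := by
    have := hP.norm_le t (hs.trans_le hst)
    have := hP.norm_le s hs
    linarith [_root_.norm_sub_le (P t) (P s)]
  rw [Real.norm_of_nonneg (sub_nonneg.2 hst)] at h1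
  set x := (t - s) / s
  have hx : 0 ≤ x := div_nonneg (sub_nonneg.2 hst) hs.le
  have e : 2 * √(t - s) * s ^ (-(1 / 2) : ℝ) = 2 * √x := by
    rw [Real.sqrt_div' _ hs.le, Real.rpow_neg hs.le, ← Real.sqrt_eq_rpow]; ring
  rw [e]
  have h1' : ‖P t - P s‖ ≤ 2 * x := by convert h1 using 1; ring
  have := Real.sq_sqrt hx
  rcases le_total x 1 with h | h
  · have : x ≤ √x := by
      nlinarith [Real.sqrt_nonneg x, Real.sqrt_le_one.2 h]
    linarith
  · have : 1 ≤ √x := Real.one_le_sqrt.2 h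
    linarith

/-- The convolution `∫₀ᵗ P (t - s) F s ds`. -/
noncomputable def convolve (P F : ℝ → 𝓐) (t : ℝ) : 𝓐 := ∫ s in (0 : ℝ)..t, P (t - s) * F s

theorem convolve_zero (P F : ℝ → 𝓐) : convolve P F 0 = 0 := intervalIntegral.integral_same

theorem IsHeatSemigroup.continuousOn_mul (hP : IsHeatSemigroup R P K) {F : ℝ → 𝓐}
    (hF : ContinuousOn F (Ioi 0)) (t : ℝ) :
    ContinuousOn (fun s => P (t - s) * F s) (Ioo 0 t) :=
  (hP.continuousOn.comp (continuousOn_const.sub continuousOn_id)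
    fun _ hs => sub_pos.2 hs.2).mul (hF.mono fun _ hs => hs.1)

theorem IsHeatSemigroup.norm_mul_le (hP : IsHeatSemigroup R P K) {F : ℝ → 𝓐} {M r s : ℝ}
    (hr : 0 < r) (hM : ‖F s‖ ≤ M) : ‖P r * F s‖ ≤ M := by
  calc ‖P r * F s‖ ≤ ‖P r‖ * ‖F s‖ := _root_.norm_mul_le _ _
    _ ≤ 1 * M := by gcongr; exact hP.norm_le _ hr
    _ = M := one_mul M

theorem IsHeatSemigroup.intervalIntegrable (hP : IsHeatSemigroup R P K) {F : ℝ → 𝓐}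
    (hF : ContinuousOn F (Ioi 0)) {T M t : ℝ} (hM : ∀ s ∈ Ioc 0 T, ‖F s‖ ≤ M) (ht : t ∈ Icc 0 T) :
    IntervalIntegrable (fun s => P (t - s) * F s) volume 0 t :=
  intervalIntegrable_of_continuousOn_of_norm_le ht.1 (hP.continuousOn_mul hF t)
    (intervalIntegrable_const (c := M)) fun s hs =>
      hP.norm_mul_le (sub_pos.2 hs.2) (hM s ⟨hs.1, hs.2.le.trans ht.2⟩)

theorem IsHeatSemigroup.norm_convolve_sub_le (hP : IsHeatSemigroup R P K) {F : ℝ → 𝓐}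
    (hF : ContinuousOn F (Ioi 0)) {T M s t : ℝ} (hM : ∀ s ∈ Ioc 0 T, ‖F s‖ ≤ M) (hs : 0 ≤ s)
    (hst : s ≤ t) (ht : t ≤ T) (hM0 : 0 ≤ M) :
    ‖convolve P F t - convolve P F s‖ ≤ 5 * M * √T * √(t - s) := by
  have i1 := hP.intervalIntegrable hF hM ⟨hs.trans hst, ht⟩
  have i2 := hP.intervalIntegrable hF hM ⟨hs, hst.trans ht⟩
  have m1 : s ∈ uIcc 0 t := by rw [uIcc_of_le (hs.trans hst)]; exact ⟨hs, hst⟩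
  have i3 := i1.mono_set (uIcc_subset_uIcc_left m1)
  have i4 := i1.mono_set (uIcc_subset_uIcc_right m1)
  have e : convolve P F t - convolve P F s
      = (∫ r in (0 : ℝ)..s, (P (t - r) - P (s - r)) * F r) + ∫ r in s..t, P (t - r) * F r := by
    simp only [convolve, sub_mul]
    rw [intervalIntegral.integral_sub i3 i2,
      ← intervalIntegral.integral_add_adjacent_intervals i3 i4]
    abel
  have b1 : ‖∫ r in (0 : ℝ)..s, (P (t - r) - P (s - r)) * F r‖ ≤ 4 * M * √T * √(t - s) := by
    have := norm_intervalIntegral_le_of_norm_le_Ioo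
      (f := fun r => (P (t - r) - P (s - r)) * F r)
      (g := fun r => 2 * √(t - s) * M * (s - r) ^ (-(1 / 2) : ℝ)) hs
      ((intervalIntegrable_sub_rpow s).const_mul _) (fun r hr => by
        calc ‖(P (t - r) - P (s - r)) * F r‖ ≤ ‖P (t - r) - P (s - r)‖ * ‖F r‖ := _root_.norm_mul_le _ _
          _ ≤ (2 * √(t - r - (s - r)) * (s - r) ^ (-(1 / 2) : ℝ)) * M := by
              have h0 : 0 < s - r := sub_pos.2 hr.2
              exact mul_le_mul (hP.norm_sub_le h0 (by linarith))
                (hM r ⟨hr.1, by linarith [hr.2]⟩) (norm_nonneg _) (by positivity)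
          _ = _ := by rw [sub_sub_sub_cancel_right]; ring)
    refine this.trans ?_
    rw [intervalIntegral.integral_const_mul, integral_sub_rpow s]
    have : √s ≤ √T := Real.sqrt_le_sqrt (hst.trans ht)
    calc 2 * √(t - s) * M * (2 * √s) = 4 * M * √s * √(t - s) := by ring
      _ ≤ _ := by gcongr
  have b2 : ‖∫ r in s..t, P (t - r) * F r‖ ≤ M * √T * √(t - s) := by
    refine (norm_intervalIntegral_le_const_Ioo hst fun r hr =>
      hP.norm_mul_le (sub_pos.2 hr.2) (hM r ⟨hs.trans_lt hr.1, hr.2.le.trans ht⟩)).trans ?_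
    have h1 : √(t - s) ≤ √T := Real.sqrt_le_sqrt (by linarith)
    have h2 := Real.mul_self_sqrt (sub_nonneg.2 hst)
    calc M * (t - s) = M * √(t - s) * √(t - s) := by rw [mul_assoc, h2]
      _ ≤ _ := by gcongr
  rw [e]
  linarith [norm_add_le (∫ r in (0 : ℝ)..s, (P (t - r) - P (s - r)) * F r)
    (∫ r in s..t, P (t - r) * F r)]

/-- `F` is continuous on `(0, ∞)` and bounded near `0`. -/
def LocallyBoundedContinuous (F : ℝ → 𝓐) : Prop :=
  ContinuousOn F (Ioi 0) ∧ ∀ T, ∃ M, 0 ≤ M ∧ ∀ s ∈ Ioc 0 T, ‖F s‖ ≤ M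

theorem IsHeatSemigroup.exists_norm_convolve_sub_le (hP : IsHeatSemigroup R P K) {F : ℝ → 𝓐}
    (hF : LocallyBoundedContinuous F) (T : ℝ) : ∃ L, 0 ≤ L ∧ ∀ s ∈ Icc 0 T, ∀ t ∈ Icc 0 T,
      ‖convolve P F t - convolve P F s‖ ≤ L * √|t - s| := by
  obtain ⟨M, hM0, hM⟩ := hF.2 T
  refine ⟨5 * M * √T, by positivity, fun s hs t ht => ?_⟩
  rcases le_total s t with h | h
  · rw [abs_of_nonneg (sub_nonneg.2 h)]
    exact hP.norm_convolve_sub_le hF.1 hM hs.1 h ht.2 hM0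
  · rw [norm_sub_rev, abs_of_nonpos (sub_nonpos.2 h), neg_sub]
    exact hP.norm_convolve_sub_le hF.1 hM ht.1 h hs.2 hM0

theorem continuousOn_of_norm_sub_le_sqrt {E : Type*} [NormedAddCommGroup E] {f : ℝ → E} {S : Set ℝ}
    {L : ℝ} (h : ∀ s ∈ S, ∀ t ∈ S, ‖f t - f s‖ ≤ L * √|t - s|) : ContinuousOn f S := by
  intro s hs
  rw [ContinuousWithinAt, tendsto_iff_norm_sub_tendsto_zero]
  have : Filter.Tendsto (fun t => L * √|t - s|) (𝓝[S] s) (𝓝 0) := by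
    have : Continuous fun t => L * √|t - s| := by fun_prop
    simpa [ContinuousWithinAt] using this.continuousWithinAt (s := S) (x := s)
  refine squeeze_zero' (Filter.Eventually.of_forall fun _ => norm_nonneg _) ?_ this
  filter_upwards [self_mem_nhdsWithin] with t ht using h s hs t ht

theorem IsHeatSemigroup.continuousOn_convolve (hP : IsHeatSemigroup R P K) {F : ℝ → 𝓐}
    (hF : LocallyBoundedContinuous F) : ContinuousOn (convolve P F) (Ici 0) := by
  intro t ht
  obtain ⟨L, -, hL⟩ := hP.exists_norm_convolve_sub_le hF (t + 1)
  refine ((continuousOn_of_norm_sub_le_sqrt hL) t ⟨ht, by linarith⟩).mono_of_mem_nhdsWithin ?_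
  rw [← Ici_inter_Iic]
  exact inter_mem_nhdsWithin _ (Iic_mem_nhds (by linarith))

end Convolution

section Regularity

variable {𝓐 : Type*} [NormedRing 𝓐] [NormedAlgebra ℝ 𝓐]

theorem mul_intervalIntegral [CompleteSpace 𝓐] (x : 𝓐) {f : ℝ → 𝓐} {a b : ℝ}
    (hf : IntervalIntegrable f volume a b) : x * ∫ s in a..b, f s = ∫ s in a..b, x * f s :=
  ((ContinuousLinearMap.mul ℝ 𝓐 x).intervalIntegral_comp_comm hf).symm

theorem intervalIntegral_mul [CompleteSpace 𝓐] (x : 𝓐) {f : ℝ → 𝓐} {a b : ℝ}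
    (hf : IntervalIntegrable f volume a b) : (∫ s in a..b, f s) * x = ∫ s in a..b, f s * x :=
  (((ContinuousLinearMap.mul ℝ 𝓐).flip x).intervalIntegral_comp_comm hf).symm

theorem IntervalIntegrable.smul_const_mul {f : ℝ → 𝓐} {a b : ℝ}
    (hf : IntervalIntegrable f volume a b) (c : ℝ) (x : 𝓐) :
    IntervalIntegrable (fun s => c • (x * f s)) volume a b := by
  have := (hf.const_mul x).smul c
  exact this

/-- `F` is Hölder continuous with exponent `1/2` on compact subintervals of `(0, ∞)`. -/
def LocallyHolderHalf (F : ℝ → 𝓐) : Prop :=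
  ∀ a T : ℝ, 0 < a → ∃ L, 0 ≤ L ∧ ∀ s ∈ Icc a T, ∀ t ∈ Icc a T, ‖F t - F s‖ ≤ L * √|t - s|

theorem LocallyHolderHalf.exists_norm_sub_le {F : ℝ → 𝓐} (hH : LocallyHolderHalf F)
    (hF : LocallyBoundedContinuous F) {a : ℝ} (T : ℝ) (ha : 0 < a) :
    ∃ L, 0 ≤ L ∧ ∀ t ∈ Icc a T, ∀ s ∈ Ioo 0 t, ‖F s - F t‖ ≤ L * √(t - s) := by
  obtain ⟨L, hL0, hL⟩ := hH (a / 2) T (half_pos ha)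
  obtain ⟨M, hM0, hM⟩ := hF.2 T
  refine ⟨L + 2 * M / √(a / 2), by positivity, fun t ht s hs => ?_⟩
  rw [add_mul]
  rcases le_total (a / 2) s with h | h
  · have := hL t ⟨by linarith [ht.1], ht.2⟩ s ⟨h, by linarith [hs.2, ht.2]⟩
    rw [abs_sub_comm, abs_of_nonneg (sub_nonneg.2 hs.2.le)] at this
    have : 0 ≤ 2 * M / √(a / 2) * √(t - s) := by positivity
    linarith
  · have h1 := hM s ⟨hs.1, by linarith [hs.2, ht.2]⟩
    have h2 := hM t ⟨by linarith [ht.1], ht.2⟩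
    have h3 : √(a / 2) ≤ √(t - s) := Real.sqrt_le_sqrt (by linarith [ht.1])
    have h4 : 0 < √(a / 2) := Real.sqrt_pos.2 (half_pos ha)
    have h5 : 2 * M ≤ 2 * M / √(a / 2) * √(t - s) := by
      rw [div_mul_eq_mul_div, le_div_iff₀ h4]
      gcongr
    have : 0 ≤ L * √(t - s) := by positivity
    linarith [norm_sub_le (F s) (F t)]

variable {R : 𝓐} {P K : ℝ → 𝓐}

/-- The integral `∫₀ᵗ K (t - s) (F s - F t) ds`, which converges for Hölder continuous `F`. -/
noncomputable def convolveGen (K F : ℝ → 𝓐) (t : ℝ) : 𝓐 :=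
  ∫ s in (0 : ℝ)..t, K (t - s) * (F s - F t)

theorem IsHeatSemigroup.norm_gen_mul_le (hP : IsHeatSemigroup R P K) {F : ℝ → 𝓐} {L s t : ℝ}
    (hs : s < t) (h : ‖F s - F t‖ ≤ L * √(t - s)) :
    ‖K (t - s) * (F s - F t)‖ ≤ L * (t - s) ^ (-(1 / 2) : ℝ) := by
  have h0 : 0 < t - s := sub_pos.2 hs
  calc ‖K (t - s) * (F s - F t)‖ ≤ ‖K (t - s)‖ * ‖F s - F t‖ := _root_.norm_mul_le _ _
    _ ≤ 1 / (t - s) * (L * √(t - s)) :=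
        mul_le_mul (hP.norm_gen_le _ h0) h (norm_nonneg _) (by positivity)
    _ = _ := by
        have h1 := Real.mul_self_sqrt h0.le
        have h2 : √(t - s) ≠ 0 := (Real.sqrt_pos.2 h0).ne'
        rw [Real.rpow_neg h0.le, ← Real.sqrt_eq_rpow]
        nth_rewrite 1 [← h1]
        field_simp

theorem IsHeatSemigroup.intervalIntegrable_gen (hP : IsHeatSemigroup R P K) {F : ℝ → 𝓐}
    (hF : LocallyBoundedContinuous F) (hH : LocallyHolderHalf F) {t : ℝ} (ht : 0 < t) :
    IntervalIntegrable (fun s => K (t - s) * (F s - F t)) volume 0 t := by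
  obtain ⟨L, -, hL⟩ := hH.exists_norm_sub_le hF t ht
  refine intervalIntegrable_of_continuousOn_of_norm_le ht.le ?_
    ((intervalIntegrable_sub_rpow t).const_mul L) fun s hs =>
      hP.norm_gen_mul_le hs.2 (hL t ⟨le_rfl, le_rfl⟩ s hs)
  exact (hP.continuousOn_gen.comp (continuousOn_const.sub continuousOn_id)
    fun _ hs => sub_pos.2 hs.2).mul ((hF.1.mono fun _ hs => hs.1).sub continuousOn_const)

theorem IsHeatSemigroup.continuousAt_convolveGen (hP : IsHeatSemigroup R P K) {F : ℝ → 𝓐}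
    (hF : LocallyBoundedContinuous F) (hH : LocallyHolderHalf F) {t : ℝ} (ht : 0 < t) :
    ContinuousAt (convolveGen K F) t := by
  have e : ∀ r, 0 < r → convolveGen K F r
      = r • ∫ u in (0 : ℝ)..1, K (r - r * u) * (F (r * u) - F r) := by
    intro r hr
    rw [intervalIntegral.integral_comp_mul_left (fun s => K (r - s) * (F s - F r)) hr.ne',
      smul_smul, mul_inv_cancel₀ hr.ne', one_smul, mul_zero, mul_one, convolveGen]
  have hev : ∀ᶠ r in 𝓝 t, r ∈ Ioo (t / 2) (2 * t) := Ioo_mem_nhds (by linarith) (by linarith)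
  refine ContinuousAt.congr ?_ (hev.mono fun r hr => (e r (by linarith [hr.1])).symm)
  refine continuousAt_id.smul ?_
  obtain ⟨L, hL0, hL⟩ := hH.exists_norm_sub_le hF (2 * t) (half_pos ht)
  have hne : ∀ᵐ u : ℝ, u ≠ 1 := by simp [ae_iff]
  have hcF : ∀ r, 0 < r → ContinuousAt F r := fun r hr => hF.1.continuousAt (Ioi_mem_nhds hr)
  refine intervalIntegral.continuousAt_of_dominated_interval
    (bound := fun u => L * (t / 2) ^ (-(1 / 2) : ℝ) * (1 - u) ^ (-(1 / 2) : ℝ)) ?_ ?_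
    ((intervalIntegrable_sub_rpow 1).const_mul _) ?_
  · filter_upwards [hev] with r hr
    have hr0 : 0 < r := by linarith [hr.1]
    have := (hP.intervalIntegrable_gen hF hH hr0).comp_mul_left (c := r)
    rw [zero_div, div_self hr0.ne'] at this
    rw [uIoc_of_le zero_le_one]
    exact this.1.aestronglyMeasurable
  · filter_upwards [hev] with r hr
    filter_upwards [hne] with u hu hu'
    rw [uIoc_of_le zero_le_one] at hu'
    have hu1 : u < 1 := lt_of_le_of_ne hu'.2 hu
    have hr0 : 0 < r := by linarith [hr.1]
    have hru : r * u < r := by nlinarith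
    refine (hP.norm_gen_mul_le hru (hL r ⟨hr.1.le, hr.2.le⟩ _ ⟨mul_pos hr0 hu'.1, hru⟩)).trans ?_
    have h1 : (r - r * u) ^ (-(1 / 2) : ℝ) = r ^ (-(1 / 2) : ℝ) * (1 - u) ^ (-(1 / 2) : ℝ) := by
      rw [← Real.mul_rpow hr0.le (sub_nonneg.2 hu1.le)]; ring_nf
    rw [h1, mul_assoc]
    have h2 : r ^ (-(1 / 2) : ℝ) ≤ (t / 2) ^ (-(1 / 2) : ℝ) :=
      Real.rpow_le_rpow_of_nonpos (half_pos ht) hr.1.le (by norm_num)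
    have h3 : 0 ≤ (1 - u) ^ (-(1 / 2) : ℝ) := Real.rpow_nonneg (sub_nonneg.2 hu1.le) _
    gcongr
  · filter_upwards [hne] with u hu hu'
    rw [uIoc_of_le zero_le_one] at hu'
    have hu1 : u < 1 := lt_of_le_of_ne hu'.2 hu
    have h1 : 0 < t - t * u := by nlinarith
    have c1 : ContinuousAt (fun r => K (r - r * u)) t :=
      ContinuousAt.comp (g := K) (hP.continuousAt_gen _ h1) (by fun_prop)
    have c2 : ContinuousAt (fun r => F (r * u)) t :=
      ContinuousAt.comp (g := F) (hcF _ (mul_pos ht hu'.1)) (by fun_prop)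
    exact c1.mul (c2.sub (hcF t ht))

theorem IsHeatSemigroup.intervalIntegrable_self (hP : IsHeatSemigroup R P K) {t : ℝ}
    (ht : 0 ≤ t) : IntervalIntegrable P volume 0 t :=
  intervalIntegrable_of_continuousOn_of_norm_le ht (hP.continuousOn.mono fun _ hs => hs.1)
    (intervalIntegrable_const (c := 1)) fun s hs => hP.norm_le s hs.1

theorem IsHeatSemigroup.integral_self [CompleteSpace 𝓐] (hP : IsHeatSemigroup R P K) {t : ℝ}
    (ht : 0 ≤ t) : (2 : ℝ) • ((1 - R) * ∫ s in (0 : ℝ)..t, P s) = R - R * P t := by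
  rw [mul_intervalIntegral _ (hP.intervalIntegrable_self ht), ← intervalIntegral.integral_smul]
  have := intervalIntegral.integral_eq_sub_of_hasDerivAt_of_le (f := fun s => -(R * P s))
    (f' := fun s => (2 : ℝ) • ((1 - R) * P s)) ht ?_ ?_ ?_
  · rw [this, hP.zero, mul_one]; abel
  · intro s hs
    rcases hs.1.eq_or_lt with rfl | hs0
    · refine ContinuousWithinAt.neg ?_
      rw [ContinuousWithinAt, hP.zero, mul_one, tendsto_iff_norm_sub_tendsto_zero]
      have h2 : Filter.Tendsto (fun s : ℝ => 2 * s) (𝓝[Icc 0 t] 0) (𝓝 0) := by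
        have : Continuous fun s : ℝ => 2 * s := by fun_prop
        simpa [ContinuousWithinAt] using this.continuousWithinAt (s := Icc 0 t) (x := 0)
      refine squeeze_zero' (Filter.Eventually.of_forall fun _ => norm_nonneg _) ?_ h2
      filter_upwards [self_mem_nhdsWithin] with s hs
      rcases hs.1.eq_or_lt with rfl | hs0
      · simp [hP.zero]
      · exact hP.norm_mul_sub_le s hs0
    · exact ((hP.hasDerivAt s hs0).continuousAt.const_mul R).neg.continuousWithinAt
  · intro s hs
    have := ((hP.hasDerivAt s hs.1).const_mul R).neg
    rw [mul_smul_comm, hP.mul_gen s hs.1, neg_smul, neg_neg] at this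
    exact this
  · exact (hP.intervalIntegrable_self ht).smul_const_mul _ _

theorem IsHeatSemigroup.integral_convolve [CompleteSpace 𝓐] (hP : IsHeatSemigroup R P K)
    {F : ℝ → 𝓐} (hF : LocallyBoundedContinuous F) {t : ℝ} (ht : 0 ≤ t) :
    ∫ r in (0 : ℝ)..t, convolve P F r
      = ∫ s in (0 : ℝ)..t, (∫ r in (0 : ℝ)..(t - s), P r) * F s := by
  obtain ⟨M, hM0, hM⟩ := hF.2 t
  set μ : Measure ℝ := volume.restrict (Ioo 0 t)
  set f : ℝ → ℝ → 𝓐 := fun r s => (Iio r).indicator (fun s => P (r - s) * F s) s with hf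
  have hint : Integrable (Function.uncurry f) (μ.prod μ) := by
    have hO : MeasurableSet {p : ℝ × ℝ | p.2 < p.1} := measurableSet_lt measurable_snd measurable_fst
    have e : Function.uncurry f
        = {p : ℝ × ℝ | p.2 < p.1}.indicator fun p => P (p.1 - p.2) * F p.2 := by
      funext p
      simp only [Function.uncurry, hf, indicator, mem_Iio, mem_ofPred_eq]
    rw [e, integrable_indicator_iff hO, Measure.prod_restrict, IntegrableOn,
      Measure.restrict_restrict hO]
    set O := {p : ℝ × ℝ | p.2 < p.1} ∩ Ioo 0 t ×ˢ Ioo 0 t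
    have hOm : MeasurableSet O := hO.inter (measurableSet_Ioo.prod measurableSet_Ioo)
    have hfin : (volume.prod volume) O ≠ ⊤ := by
      refine ((measure_mono inter_subset_right).trans_lt ?_).ne
      rw [Measure.prod_prod]
      exact ENNReal.mul_lt_top measure_Ioo_lt_top measure_Ioo_lt_top
    refine Integrable.mono' (g := fun _ => M) (integrableOn_const hfin) ?_ ?_
    · refine ContinuousOn.aestronglyMeasurable ?_ hOm
      exact (hP.continuousOn.comp (by fun_prop) fun p hp => sub_pos.2 (show p.2 < p.1 from hp.1)).mul
        (hF.1.comp (by fun_prop) fun p hp => hp.2.2.1)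
    · exact ae_restrict_of_forall_mem hOm fun p hp =>
        hP.norm_mul_le (sub_pos.2 (show p.2 < p.1 from hp.1)) (hM p.2 ⟨hp.2.2.1, hp.2.2.2.le⟩)
  have hswap := integral_integral_swap hint
  have e1 : ∫ r, ∫ s, f r s ∂μ ∂μ = ∫ r in (0 : ℝ)..t, convolve P F r := by
    rw [intervalIntegral.integral_of_le ht, integral_Ioc_eq_integral_Ioo]
    refine setIntegral_congr_fun measurableSet_Ioo fun r hr => ?_
    simp only [hf, convolve]
    rw [integral_indicator measurableSet_Iio, Measure.restrict_restrict measurableSet_Iio,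
      intervalIntegral.integral_of_le hr.1.le, integral_Ioc_eq_integral_Ioo]
    congr 2
    ext s
    simp only [mem_inter_iff, mem_Iio, mem_Ioo]
    exact ⟨fun h => ⟨h.2.1, h.1⟩, fun h => ⟨h.2, h.1, h.2.trans hr.2⟩⟩
  have e2 : ∫ s, ∫ r, f r s ∂μ ∂μ = ∫ s in (0 : ℝ)..t, (∫ r in (0 : ℝ)..(t - s), P r) * F s := by
    rw [intervalIntegral.integral_of_le ht, integral_Ioc_eq_integral_Ioo]
    refine setIntegral_congr_fun measurableSet_Ioo fun s hs => ?_
    have e3 : (fun r => f r s) = (Ioi s).indicator fun r => P (r - s) * F s := by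
      funext r
      simp only [hf, indicator, mem_Iio, mem_Ioi]
    have e4 : Ioi s ∩ Ioo 0 t = Ioo s t := by
      ext r
      simp only [mem_inter_iff, mem_Ioi, mem_Ioo]
      exact ⟨fun h => ⟨h.1, h.2.2⟩, fun h => ⟨h.1, hs.1.trans h.1, h.2⟩⟩
    rw [e3, integral_indicator measurableSet_Ioi, Measure.restrict_restrict measurableSet_Ioi, e4,
      ← integral_Ioc_eq_integral_Ioo, ← intervalIntegral.integral_of_le hs.2.le,
      intervalIntegral_mul _ (hP.intervalIntegrable_self (sub_nonneg.2 hs.2.le)),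
      intervalIntegral.integral_comp_sub_right (fun r => P r * F s), sub_self]
  rw [← e1, hswap, e2]

/-- The norm derivative of the convolution `∫₀ᵗ P (t - s) F s ds`. -/
noncomputable def convolveDeriv (P K F : ℝ → 𝓐) (t : ℝ) : 𝓐 :=
  P t * F t - (2 : ℝ) • convolveGen K F t

theorem LocallyBoundedContinuous.intervalIntegrable {F : ℝ → 𝓐}
    (hF : LocallyBoundedContinuous F) {t : ℝ} (ht : 0 ≤ t) : IntervalIntegrable F volume 0 t := by
  obtain ⟨M, -, hM⟩ := hF.2 t
  exact intervalIntegrable_of_continuousOn_of_norm_le ht (hF.1.mono fun _ hs => hs.1)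
    (intervalIntegrable_const (c := M)) fun s hs => hM s ⟨hs.1, hs.2.le⟩

theorem IsHeatSemigroup.mul_convolveDeriv [CompleteSpace 𝓐] (hP : IsHeatSemigroup R P K)
    {F : ℝ → 𝓐} (hF : LocallyBoundedContinuous F) (hH : LocallyHolderHalf F) {t : ℝ}
    (ht : 0 < t) :
    R * convolveDeriv P K F t = R * F t - (2 : ℝ) • ((1 - R) * convolve P F t) := by
  obtain ⟨M, -, hM⟩ := hF.2 t
  have i1 := hP.intervalIntegrable hF.1 hM ⟨ht.le, le_rfl⟩
  have i2 : IntervalIntegrable (fun s => P (t - s)) volume 0 t := by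
    simpa using ((hP.intervalIntegrable_self ht.le).comp_sub_left t).symm
  have e : R * convolveGen K F t
      = (1 - R) * convolve P F t - ((1 - R) * ∫ s in (0 : ℝ)..t, P s) * F t := by
    have e1 : R * convolveGen K F t
        = ∫ s in (0 : ℝ)..t, (1 - R) * (P (t - s) * F s - P (t - s) * F t) := by
      rw [convolveGen, mul_intervalIntegral _ (hP.intervalIntegrable_gen hF hH ht)]
      refine intervalIntegral_congr_Ioo ht.le fun s hs => ?_
      rw [← mul_assoc, hP.mul_gen _ (sub_pos.2 hs.2), mul_assoc, mul_sub]
    have e2 : ∫ s in (0 : ℝ)..t, P (t - s) = ∫ s in (0 : ℝ)..t, P s := by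
      rw [intervalIntegral.integral_comp_sub_left P t, sub_self, sub_zero]
    rw [e1, ← mul_intervalIntegral _ (i1.sub (i2.mul_const _)),
      intervalIntegral.integral_sub i1 (i2.mul_const _), ← intervalIntegral_mul _ i2, e2, mul_sub,
      mul_assoc, convolve]
  have h := hP.integral_self ht.le
  rw [convolveDeriv, mul_sub, mul_smul_comm, e, smul_sub,
    ← smul_mul_assoc (2 : ℝ) ((1 - R) * ∫ s in (0 : ℝ)..t, P s), h, sub_mul R, mul_assoc R]
  abel

theorem IsHeatSemigroup.mul_convolve [CompleteSpace 𝓐] (hP : IsHeatSemigroup R P K)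
    {F : ℝ → 𝓐} (hF : LocallyBoundedContinuous F) {t : ℝ} (ht : 0 ≤ t) :
    R * convolve P F t = R * (∫ s in (0 : ℝ)..t, F s)
      - (2 : ℝ) • ((1 - R) * ∫ s in (0 : ℝ)..t, convolve P F s) := by
  obtain ⟨M, hM0, hM⟩ := hF.2 t
  have i1 := hP.intervalIntegrable hF.1 hM ⟨ht, le_rfl⟩
  have i3 : IntervalIntegrable (fun s => (∫ r in (0 : ℝ)..(t - s), P r) * F s) volume 0 t := by
    refine intervalIntegrable_of_continuousOn_of_norm_le ht ?_
      (intervalIntegrable_const (c := t * M)) fun s hs => ?_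
    · have c : ContinuousOn (fun x => ∫ r in (0 : ℝ)..x, P r) (uIcc 0 t) :=
        intervalIntegral.continuousOn_primitive_interval
          ((intervalIntegrable_iff_integrableOn_Icc_of_le ht).1
            (hP.intervalIntegrable_self ht) |>.mono_set (uIcc_of_le ht).subset)
      refine (c.comp (continuousOn_const.sub continuousOn_id) fun s hs => ?_).mul
        (hF.1.mono fun _ hs => hs.1)
      rw [uIcc_of_le ht]
      exact ⟨sub_nonneg.2 hs.2.le, by simpa using hs.1.le⟩
    · refine (_root_.norm_mul_le _ _).trans (mul_le_mul ?_ (hM s ⟨hs.1, hs.2.le⟩) (norm_nonneg _) ht)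
      have := norm_intervalIntegral_le_const_Ioo (f := P) (M := 1) (sub_nonneg.2 hs.2.le)
        fun r hr => hP.norm_le r hr.1
      linarith [hs.1]
  rw [hP.integral_convolve hF ht, mul_intervalIntegral _ i3, ← intervalIntegral.integral_smul,
    mul_intervalIntegral _ (hF.intervalIntegrable ht), convolve, mul_intervalIntegral _ i1,
    ← intervalIntegral.integral_sub ((hF.intervalIntegrable ht).const_mul R)
      (i3.smul_const_mul _ _)]
  refine intervalIntegral_congr_Ioo ht fun s hs => ?_
  rw [← mul_assoc, ← mul_assoc, ← smul_mul_assoc, hP.integral_self (sub_nonneg.2 hs.2.le), sub_mul]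
  abel

theorem IsHeatSemigroup.continuousAt_convolveDeriv (hP : IsHeatSemigroup R P K)
    {F : ℝ → 𝓐} (hF : LocallyBoundedContinuous F) (hH : LocallyHolderHalf F) {t : ℝ}
    (ht : 0 < t) : ContinuousAt (convolveDeriv P K F) t :=
  ((hP.hasDerivAt t ht).continuousAt.mul (hF.1.continuousAt (Ioi_mem_nhds ht))).sub
    ((hP.continuousAt_convolveGen hF hH ht).const_smul _)

theorem hasDerivAt_integral_of_continuousOn {E : Type*} [NormedAddCommGroup E] [NormedSpace ℝ E]
    [CompleteSpace E] {f : ℝ → E} {a t : ℝ} (hf : ContinuousOn f (Ioi 0))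
    (hi : IntervalIntegrable f volume a t) (ht : 0 < t) :
    HasDerivAt (fun u => ∫ s in a..u, f s) (f t) t :=
  intervalIntegral.integral_hasDerivAt_right hi
    (hf.stronglyMeasurableAtFilter isOpen_Ioi t ht) (hf.continuousAt (Ioi_mem_nhds ht))

theorem IsHeatSemigroup.hasDerivAt_convolve [CompleteSpace 𝓐] (hP : IsHeatSemigroup R P K)
    {F : ℝ → 𝓐} (hF : LocallyBoundedContinuous F) (hH : LocallyHolderHalf F) {t : ℝ}
    (ht : 0 < t) : HasDerivAt (convolve P F) (convolveDeriv P K F t) t := by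
  have cg : ContinuousOn (convolveDeriv P K F) (Ioi 0) := fun s hs =>
    (hP.continuousAt_convolveDeriv hF hH hs).continuousWithinAt
  have cV := hP.continuousOn_convolve hF
  have ig : ∀ s, 0 < s → IntervalIntegrable (convolveDeriv P K F) volume t s := fun s hs =>
    (cg.mono fun r hr => (lt_min ht hs).trans_le hr.1).intervalIntegrable
  have dR : ∀ s, 0 < s → HasDerivAt (fun r => R * convolve P F r)
      (R * convolveDeriv P K F s) s := by
    intro s hs
    have iV : IntervalIntegrable (convolve P F) volume 0 s := by
      refine ContinuousOn.intervalIntegrable ?_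
      rw [uIcc_of_le hs.le]
      exact cV.mono fun r hr => hr.1
    have := ((hasDerivAt_integral_of_continuousOn hF.1 (hF.intervalIntegrable hs.le) hs).const_mul
      R).sub (((hasDerivAt_integral_of_continuousOn (cV.mono Ioi_subset_Ici_self) iV hs).const_mul
        (1 - R)).const_smul (2 : ℝ))
    rw [hP.mul_convolveDeriv hF hH hs]
    refine this.congr_of_eventuallyEq ?_
    filter_upwards [lt_mem_nhds hs] with r hr using hP.mul_convolve hF hr.le
  have key : ∀ s, 0 < s → convolve P F s = convolve P F t + ∫ r in t..s, convolveDeriv P K F r := by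
    intro s hs
    rw [← sub_eq_zero]
    refine hP.cancel _ ?_
    have h := intervalIntegral.integral_eq_sub_of_hasDerivAt (a := t) (b := s)
      (f := fun r => R * convolve P F r) (f' := fun r => R * convolveDeriv P K F r)
      (fun r hr => dR r ((lt_min ht hs).trans_le hr.1)) ((ig s hs).const_mul R)
    rw [mul_sub, mul_add, mul_intervalIntegral _ (ig s hs), h]
    abel
  have := (hasDerivAt_integral_of_continuousOn cg (ig t ht) ht).const_add (convolve P F t)
  refine this.congr_of_eventuallyEq ?_
  filter_upwards [lt_mem_nhds ht] with s hs using key s hs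

end Regularity

/-- Global fixed points of maps with a Volterra-type Lipschitz estimate, by Picard iteration. -/
theorem exists_fixedPoint_of_volterra {E : Type*} [NormedAddCommGroup E] [CompleteSpace E]
    (Φ : (ℝ → E) → ℝ → E)
    (hc : ∀ u, ContinuousOn u (Ioi 0) → ContinuousOn (Φ u) (Ioi 0))
    (h0 : ∀ T, ∃ c, 0 ≤ c ∧ ∀ t ∈ Ioc 0 T, ‖Φ 0 t‖ ≤ c)
    (hL : ∀ T, ∃ L, 0 ≤ L ∧ ∀ u v, ContinuousOn u (Ioi 0) → ContinuousOn v (Ioi 0) →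
      ∀ (n : ℕ) (c : ℝ), 0 ≤ c → (∀ s ∈ Ioc 0 T, ‖u s - v s‖ ≤ c * s ^ n) →
        ∀ t ∈ Ioc 0 T, ‖Φ u t - Φ v t‖ ≤ L * c * t ^ (n + 1) / (n + 1)) :
    ∃ u, ContinuousOn u (Ioi 0) ∧ ∀ t, 0 < t → Φ u t = u t := by
  set U : ℕ → ℝ → E := fun n => Φ^[n] 0 with hU
  have hUs : ∀ n, U (n + 1) = Φ (U n) := fun n => Function.iterate_succ_apply' Φ n 0
  have hUc : ∀ n, ContinuousOn (U n) (Ioi 0) := by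
    intro n
    induction n with
    | zero => exact continuousOn_const
    | succ n ih => rw [hUs]; exact hc _ ih
  have hd : ∀ T, ∃ d : ℕ → ℝ, Summable d ∧
      ∀ t ∈ Ioc 0 T, ∀ n, dist (U n t) (U (n + 1) t) ≤ d n := by
    intro T
    obtain ⟨c, hc0, hc⟩ := h0 T
    obtain ⟨L, hL0, hL⟩ := hL T
    refine ⟨fun n => c * ((L * T) ^ n / n.factorial),
      (Real.summable_pow_div_factorial _).mul_left c, ?_⟩
    have key : ∀ n : ℕ, ∀ t ∈ Ioc 0 T,
        ‖U (n + 1) t - U n t‖ ≤ c * L ^ n / n.factorial * t ^ n := by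
      intro n
      induction n with
      | zero =>
        intro t ht
        have h1 : U 0 t = 0 := rfl
        have h2 : U 1 t = Φ 0 t := rfl
        rw [zero_add, h1, h2]
        simpa using hc t ht
      | succ n ih =>
        intro t ht
        rw [hUs (n + 1), hUs n]
        have := hL (Φ (U n)) (U n) (hUs n ▸ hUc (n + 1)) (hUc n) n
          (c * L ^ n / n.factorial) (by positivity) (by
          intro s hs; rw [← hUs]; exact ih s hs) t ht
        refine this.trans (le_of_eq ?_)
        rw [Nat.factorial_succ]
        push_cast
        field_simp
        ring
    intro t ht n
    rw [dist_comm, dist_eq_norm]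
    refine (key n t ht).trans ?_
    have h1 : t ^ n ≤ T ^ n := pow_le_pow_left₀ ht.1.le ht.2 n
    calc c * L ^ n / n.factorial * t ^ n ≤ c * L ^ n / n.factorial * T ^ n := by gcongr
      _ = c * ((L * T) ^ n / n.factorial) := by rw [mul_pow]; ring
  have hlim : ∀ t, ∃ y, 0 < t → Filter.Tendsto (fun n => U n t) Filter.atTop (𝓝 y) := by
    intro t
    by_cases ht : 0 < t
    · obtain ⟨d, hd1, hd2⟩ := hd t
      obtain ⟨y, hy⟩ := cauchySeq_tendsto_of_complete
        (cauchySeq_of_dist_le_of_summable d (hd2 t ⟨ht, le_rfl⟩) hd1)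
      exact ⟨y, fun _ => hy⟩
    · exact ⟨0, fun h => absurd h ht⟩
  choose u hu using hlim
  have hunif : ∀ T, ∃ ε : ℕ → ℝ, Filter.Tendsto ε Filter.atTop (𝓝 0) ∧
      ∀ t ∈ Ioc 0 T, ∀ n, dist (U n t) (u t) ≤ ε n := by
    intro T
    obtain ⟨d, hd1, hd2⟩ := hd T
    refine ⟨fun n => ∑' m, d (n + m), ?_, fun t ht n =>
      dist_le_tsum_of_dist_le_of_tendsto d (hd2 t ht) hd1 (hu t ht.1) n⟩
    simpa [add_comm] using tendsto_sum_nat_add d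
  have huc : ContinuousOn u (Ioi 0) := by
    intro t ht
    obtain ⟨ε, hε, hεU⟩ := hunif (t + 1)
    have hun : TendstoUniformlyOn U u Filter.atTop (Ioc 0 (t + 1)) := by
      rw [Metric.tendstoUniformlyOn_iff]
      intro δ hδ
      filter_upwards [hε.eventually (gt_mem_nhds hδ)] with n hn s hs
      rw [dist_comm]
      exact (hεU s hs n).trans_lt hn
    have := hun.continuousOn (Filter.Frequently.of_forall fun n =>
      (hUc n).mono fun _ hs => hs.1)
    refine (this t ⟨ht, by linarith⟩).mono_of_mem_nhdsWithin ?_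
    rw [← Ioi_inter_Iic]
    exact inter_mem_nhdsWithin _ (Iic_mem_nhds (by linarith))
  refine ⟨u, huc, fun t ht => ?_⟩
  obtain ⟨ε, hε, hεU⟩ := hunif t
  obtain ⟨L, hL0, hL⟩ := hL t
  have h1 : Filter.Tendsto (fun n => U (n + 1) t) Filter.atTop (𝓝 (Φ u t)) := by
    rw [tendsto_iff_dist_tendsto_zero]
    have h2 : Filter.Tendsto (fun n => L * ε n * t) Filter.atTop (𝓝 0) := by
      simpa using (hε.const_mul L).mul_const t
    refine squeeze_zero (fun _ => dist_nonneg) (fun n => ?_) h2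
    have h3 : ∀ s ∈ Ioc 0 t, ‖U n s - u s‖ ≤ ε n * s ^ 0 := fun s hs => by
      rw [← dist_eq_norm, pow_zero, mul_one]; exact hεU s hs n
    have h4 := hL (U n) u (hUc n) huc 0 (ε n)
      (dist_nonneg.trans (hεU t ⟨ht, le_rfl⟩ n)) h3 t ⟨ht, le_rfl⟩
    rw [hUs, dist_eq_norm]
    simpa using h4
  exact tendsto_nhds_unique h1 ((hu t ht).comp (Filter.tendsto_add_atTop_nat 1))

/-- Radial retraction onto the closed unit ball. -/
noncomputable def truncate {E : Type*} [NormedAddCommGroup E] [NormedSpace ℝ E] (x : E) : E :=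
  (max 1 ‖x‖)⁻¹ • x

section Truncate

variable {E : Type*} [NormedAddCommGroup E] [NormedSpace ℝ E]

theorem truncate_of_norm_le_one {x : E} (hx : ‖x‖ ≤ 1) : truncate x = x := by
  rw [truncate, max_eq_left hx, inv_one, one_smul]

theorem norm_truncate_le (x : E) : ‖truncate x‖ ≤ 1 := by
  have h : 0 < max 1 ‖x‖ := lt_max_of_lt_left one_pos
  rw [truncate, norm_smul, norm_inv, Real.norm_of_nonneg h.le, inv_mul_le_one₀ h]
  exact le_max_right _ _

theorem norm_truncate_sub_le (x y : E) : ‖truncate x - truncate y‖ ≤ 2 * ‖x - y‖ := by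
  set a := max 1 ‖x‖
  set b := max 1 ‖y‖
  have ha : 1 ≤ a := le_max_left _ _
  have hb : 1 ≤ b := le_max_left _ _
  have hy : ‖y‖ ≤ b := le_max_right _ _
  have hab : |b - a| ≤ ‖x - y‖ := by
    have h1 := abs_max_sub_max_le_abs ‖y‖ ‖x‖ 1
    rw [max_comm _ 1, max_comm _ 1] at h1
    exact h1.trans (by rw [abs_sub_comm]; exact abs_norm_sub_norm_le x y)
  have e : truncate x - truncate y = a⁻¹ • (x - y) + (a⁻¹ * b⁻¹ * (b - a)) • y := by
    have : a⁻¹ * b⁻¹ * (b - a) = a⁻¹ - b⁻¹ := by field_simp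
    rw [this, truncate, truncate, smul_sub, sub_smul]
    abel
  have h1 : ‖a⁻¹ • (x - y)‖ ≤ ‖x - y‖ := by
    rw [norm_smul, norm_inv, Real.norm_of_nonneg (by linarith)]
    exact mul_le_of_le_one_left (norm_nonneg _) (inv_le_one_of_one_le₀ ha)
  have h2 : ‖(a⁻¹ * b⁻¹ * (b - a)) • y‖ ≤ ‖x - y‖ := by
    rw [norm_smul, norm_mul, norm_mul, norm_inv, norm_inv, Real.norm_of_nonneg (by linarith : 0 ≤ a),
      Real.norm_of_nonneg (by linarith : 0 ≤ b), Real.norm_eq_abs]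
    calc a⁻¹ * b⁻¹ * |b - a| * ‖y‖ ≤ 1 * b⁻¹ * ‖x - y‖ * b := by
          gcongr
          exact inv_le_one_of_one_le₀ ha
      _ = ‖x - y‖ := by field_simp
  rw [e]
  linarith [norm_add_le (a⁻¹ • (x - y)) ((a⁻¹ * b⁻¹ * (b - a)) • y)]

theorem continuous_truncate : Continuous (truncate : E → E) := by
  refine Continuous.smul (Continuous.inv₀ (by fun_prop) fun x => ?_) continuous_id
  exact (lt_max_of_lt_left one_pos).ne'

end Truncate

section Nonlinear

variable {𝓐 : Type*} [NormedRing 𝓐] [NormedAlgebra ℝ 𝓐]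

/-- `G` is bounded and Lipschitz continuous on the unit ball with constant `c`. -/
structure LipschitzOnUnitBall (G : 𝓐 → 𝓐) (c : ℝ) : Prop where
  norm_le : ∀ x, ‖x‖ ≤ 1 → ‖G x‖ ≤ c
  norm_sub_le : ∀ x y, ‖x‖ ≤ 1 → ‖y‖ ≤ 1 → ‖G x - G y‖ ≤ c * ‖x - y‖

/-- The integral `∫₀ᵗ ρ s G(u s) ds`, with `u` truncated to the unit ball. -/
noncomputable def memory (G : 𝓐 → 𝓐) (ρ : ℝ → ℝ) (u : ℝ → 𝓐) (t : ℝ) : 𝓐 :=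
  ∫ s in (0 : ℝ)..t, ρ s • G (truncate (u s))

/-- The truncated nonlinearity `(∫₀ᵗ ρ s G(u s) ds) u t`. -/
noncomputable def forcing (G : 𝓐 → 𝓐) (ρ : ℝ → ℝ) (u : ℝ → 𝓐) (t : ℝ) : 𝓐 :=
  memory G ρ u t * truncate (u t)

variable {G : 𝓐 → 𝓐} {c : ℝ} {ρ : ℝ → ℝ} {u v : ℝ → 𝓐}

theorem LipschitzOnUnitBall.nonneg (hG : LipschitzOnUnitBall G c) : 0 ≤ c :=
  (norm_nonneg _).trans (hG.norm_le 0 (by simp))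

theorem LipschitzOnUnitBall.continuous_comp (hG : LipschitzOnUnitBall G c) :
    Continuous fun x => G (truncate x) := by
  have : LipschitzWith (Real.toNNReal (c * 2)) fun x => G (truncate x) := by
    refine LipschitzWith.of_dist_le_mul fun x y => ?_
    rw [Real.coe_toNNReal _ (mul_nonneg hG.nonneg zero_le_two), dist_eq_norm, dist_eq_norm,
      mul_assoc]
    exact (hG.norm_sub_le _ _ (norm_truncate_le x) (norm_truncate_le y)).trans
      (mul_le_mul_of_nonneg_left (norm_truncate_sub_le x y) hG.nonneg)
  exact this.continuous

theorem exists_bound_on_Icc (hρ : Continuous ρ) (T : ℝ) :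
    ∃ r, 0 ≤ r ∧ ∀ s ∈ Icc 0 T, |ρ s| ≤ r := by
  obtain ⟨r, hr⟩ := isCompact_Icc.exists_bound_of_continuousOn (s := Icc 0 T) hρ.continuousOn
  exact ⟨max r 0, le_max_right _ _, fun s hs => (hr s hs).trans (le_max_left _ _)⟩

theorem LipschitzOnUnitBall.norm_integrand_le (hG : LipschitzOnUnitBall G c) {r s : ℝ}
    (hr : |ρ s| ≤ r) : ‖ρ s • G (truncate (u s))‖ ≤ r * c := by
  rw [norm_smul, Real.norm_eq_abs]
  exact mul_le_mul hr (hG.norm_le _ (norm_truncate_le _)) (norm_nonneg _)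
    ((abs_nonneg _).trans hr)

theorem LipschitzOnUnitBall.continuousOn_integrand (hG : LipschitzOnUnitBall G c)
    (hρ : Continuous ρ) (hu : ContinuousOn u (Ioi 0)) :
    ContinuousOn (fun s => ρ s • G (truncate (u s))) (Ioi 0) :=
  hρ.continuousOn.smul (hG.continuous_comp.comp_continuousOn hu)

theorem LipschitzOnUnitBall.locallyBoundedContinuous_integrand (hG : LipschitzOnUnitBall G c)
    (hρ : Continuous ρ) (hu : ContinuousOn u (Ioi 0)) :
    LocallyBoundedContinuous fun s => ρ s • G (truncate (u s)) := by
  refine ⟨hG.continuousOn_integrand hρ hu, fun T => ?_⟩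
  obtain ⟨r, hr0, hr⟩ := exists_bound_on_Icc hρ T
  exact ⟨r * c, mul_nonneg hr0 hG.nonneg, fun s hs =>
    hG.norm_integrand_le (hr s (Ioc_subset_Icc_self hs))⟩

theorem LipschitzOnUnitBall.exists_norm_memory_sub_le (hG : LipschitzOnUnitBall G c)
    (hρ : Continuous ρ) (hu : ContinuousOn u (Ioi 0)) (T : ℝ) : ∃ L, 0 ≤ L ∧
      ∀ s ∈ Icc 0 T, ∀ t ∈ Icc 0 T, ‖memory G ρ u t - memory G ρ u s‖ ≤ L * |t - s| := by
  obtain ⟨r, hr0, hr⟩ := exists_bound_on_Icc hρ T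
  have hi := hG.locallyBoundedContinuous_integrand hρ hu
  refine ⟨r * c, mul_nonneg hr0 hG.nonneg, fun s hs t ht => ?_⟩
  rw [memory, memory, intervalIntegral.integral_interval_sub_left
    (hi.intervalIntegrable ht.1) (hi.intervalIntegrable hs.1)]
  refine intervalIntegral.norm_integral_le_of_norm_le_const fun x hx => ?_
  have hx' := uIoc_subset_uIcc hx
  exact hG.norm_integrand_le (hr x ((convex_Icc 0 T).ordConnected.uIcc_subset hs ht hx'))

theorem LipschitzOnUnitBall.exists_norm_memory_le (hG : LipschitzOnUnitBall G c)
    (hρ : Continuous ρ) (T : ℝ) : ∃ L, 0 ≤ L ∧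
      (∀ (u : ℝ → 𝓐), ∀ t ∈ Icc 0 T, ‖memory G ρ u t‖ ≤ L) ∧
      ∀ (u v : ℝ → 𝓐), ContinuousOn u (Ioi 0) → ContinuousOn v (Ioi 0) → ∀ (n : ℕ) (b : ℝ),
        0 ≤ b → (∀ s ∈ Ioc 0 T, ‖u s - v s‖ ≤ b * s ^ n) →
          ∀ t ∈ Ioc 0 T, ‖memory G ρ u t - memory G ρ v t‖ ≤ L * b * t ^ n := by
  obtain ⟨r, hr0, hr⟩ := exists_bound_on_Icc hρ T
  have hc := hG.nonneg
  refine ⟨2 * r * c * |T|, by positivity, fun u t ht => ?_, fun u v hu hv n b hb huv t ht => ?_⟩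
  · have := norm_intervalIntegral_le_const_Ioo (f := fun s => ρ s • G (truncate (u s)))
      (M := r * c) ht.1 fun s hs => hG.norm_integrand_le (hr s ⟨hs.1.le, hs.2.le.trans ht.2⟩)
    have hT : t ≤ |T| := ht.2.trans (le_abs_self T)
    refine this.trans ?_
    have : r * c * (t - 0) ≤ r * c * |T| := by rw [sub_zero]; gcongr
    have : 0 ≤ r * c * |T| := by positivity
    linarith
  · rw [memory, memory, ← intervalIntegral.integral_sub
      ((hG.locallyBoundedContinuous_integrand hρ hu).intervalIntegrable ht.1.le)
      ((hG.locallyBoundedContinuous_integrand hρ hv).intervalIntegrable ht.1.le)]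
    have := norm_intervalIntegral_le_const_Ioo (M := 2 * r * c * b * t ^ n)
      (f := fun s => ρ s • G (truncate (u s)) - ρ s • G (truncate (v s))) ht.1.le fun s hs => by
        rw [← smul_sub, norm_smul, Real.norm_eq_abs]
        have h1 := hG.norm_sub_le _ _ (norm_truncate_le (u s)) (norm_truncate_le (v s))
        have h2 := norm_truncate_sub_le (u s) (v s)
        have h3 := huv s ⟨hs.1, hs.2.le.trans ht.2⟩
        have h4 := hr s ⟨hs.1.le, hs.2.le.trans ht.2⟩
        have h5 : s ^ n ≤ t ^ n := pow_le_pow_left₀ hs.1.le hs.2.le n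
        calc |ρ s| * ‖G (truncate (u s)) - G (truncate (v s))‖
            ≤ r * (c * (2 * (b * t ^ n))) := by
              refine mul_le_mul h4 (h1.trans ?_) (norm_nonneg _) hr0
              refine mul_le_mul_of_nonneg_left (h2.trans ?_) hc
              have : b * s ^ n ≤ b * t ^ n := by gcongr
              linarith
          _ = _ := by ring
    refine this.trans ?_
    rw [sub_zero]
    have hT : t ≤ |T| := ht.2.trans (le_abs_self T)
    have ht0 := ht.1
    calc 2 * r * c * b * t ^ n * t ≤ 2 * r * c * b * t ^ n * |T| := by gcongr
      _ = _ := by ring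

theorem LipschitzOnUnitBall.continuousOn_memory (hG : LipschitzOnUnitBall G c)
    (hρ : Continuous ρ) (hu : ContinuousOn u (Ioi 0)) : ContinuousOn (memory G ρ u) (Ioi 0) := by
  intro t ht
  obtain ⟨L, hL0, hL⟩ := hG.exists_norm_memory_sub_le hρ hu (t + 1)
  have hl : LipschitzOnWith (Real.toNNReal L) (memory G ρ u) (Icc 0 (t + 1)) :=
    LipschitzOnWith.of_dist_le_mul fun x hx y hy => by
      rw [Real.coe_toNNReal _ hL0, dist_eq_norm, Real.dist_eq]; exact hL y hy x hx
  exact ((hl.continuousOn t ⟨le_of_lt ht, by linarith⟩).continuousAt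
    (Icc_mem_nhds ht (by linarith))).continuousWithinAt

theorem LipschitzOnUnitBall.locallyBoundedContinuous_forcing (hG : LipschitzOnUnitBall G c)
    (hρ : Continuous ρ) (hu : ContinuousOn u (Ioi 0)) :
    LocallyBoundedContinuous (forcing G ρ u) := by
  refine ⟨(hG.continuousOn_memory hρ hu).mul (continuous_truncate.comp_continuousOn hu),
    fun T => ?_⟩
  obtain ⟨L, hL0, hL, -⟩ := hG.exists_norm_memory_le hρ T
  refine ⟨L, hL0, fun s hs => (norm_mul_le _ _).trans ?_⟩
  have := mul_le_mul (hL u s (Ioc_subset_Icc_self hs)) (norm_truncate_le (u s)) (norm_nonneg _) hL0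
  linarith

variable {R : 𝓐} {P K : ℝ → 𝓐}

/-- Global mild solution of `W' = -2 (B + ∫₀ᵗ ρ G(W)) W`, `W 0 = 1`, for the truncated
nonlinearity. -/
theorem IsHeatSemigroup.exists_mild_solution [CompleteSpace 𝓐] (hP : IsHeatSemigroup R P K)
    (hG : LipschitzOnUnitBall G c) (hρ : Continuous ρ) :
    ∃ W : ℝ → 𝓐, ContinuousOn W (Ioi 0) ∧
      ∀ t, 0 ≤ t → W t = P t - (2 : ℝ) • convolve P (forcing G ρ W) t := by
  have hfp : ∃ w : ℝ → 𝓐, ContinuousOn w (Ioi 0) ∧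
      ∀ t, 0 < t → P t - (2 : ℝ) • convolve P (forcing G ρ w) t = w t := by
    refine exists_fixedPoint_of_volterra
      (fun u t => P t - (2 : ℝ) • convolve P (forcing G ρ u) t) ?_ ?_ ?_
    · intro u hu
      exact hP.continuousOn.sub (((hP.continuousOn_convolve
        (hG.locallyBoundedContinuous_forcing hρ hu)).mono Ioi_subset_Ici_self).const_smul _)
    · intro T
      refine ⟨1, zero_le_one, fun t ht => ?_⟩
      have : convolve P (forcing G ρ 0) t = 0 := by
        simp [convolve, forcing, truncate]
      rw [this, smul_zero, sub_zero]
      exact hP.norm_le t ht.1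
    · intro T
      obtain ⟨L, hL0, hL1, hL2⟩ := hG.exists_norm_memory_le hρ T
      refine ⟨6 * L, by positivity, fun u v hu hv n b hb huv t ht => ?_⟩
      have hFu := hG.locallyBoundedContinuous_forcing hρ hu
      have hFv := hG.locallyBoundedContinuous_forcing hρ hv
      obtain ⟨M, -, hM⟩ := hFu.2 T
      obtain ⟨M', -, hM'⟩ := hFv.2 T
      have e : (P t - (2 : ℝ) • convolve P (forcing G ρ u) t)
          - (P t - (2 : ℝ) • convolve P (forcing G ρ v) t)
          = -((2 : ℝ) • ∫ s in (0 : ℝ)..t, P (t - s) * (forcing G ρ u s - forcing G ρ v s)) := by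
        simp only [mul_sub]
        rw [intervalIntegral.integral_sub (hP.intervalIntegrable hFu.1 hM (Ioc_subset_Icc_self ht))
          (hP.intervalIntegrable hFv.1 hM' (Ioc_subset_Icc_self ht)), smul_sub]
        simp only [convolve]
        abel
      have hdiff : ∀ s ∈ Ioc 0 T, ‖forcing G ρ u s - forcing G ρ v s‖ ≤ 3 * L * b * s ^ n := by
        intro s hs
        have e2 : forcing G ρ u s - forcing G ρ v s
            = (memory G ρ u s - memory G ρ v s) * truncate (u s)
              + memory G ρ v s * (truncate (u s) - truncate (v s)) := by
          simp only [forcing]; noncomm_ring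
        have h1 := hL2 u v hu hv n b hb huv s hs
        have h2 := hL1 v s (Ioc_subset_Icc_self hs)
        have h3 := (norm_truncate_sub_le (u s) (v s)).trans
          (mul_le_mul_of_nonneg_left (huv s hs) zero_le_two)
        have hs0 := hs.1
        have h4 : ‖(memory G ρ u s - memory G ρ v s) * truncate (u s)‖ ≤ L * b * s ^ n * 1 :=
          (_root_.norm_mul_le _ _).trans
            (mul_le_mul h1 (norm_truncate_le _) (norm_nonneg _) (by positivity))
        have h5 : ‖memory G ρ v s * (truncate (u s) - truncate (v s))‖ ≤ L * (2 * (b * s ^ n)) :=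
          (_root_.norm_mul_le _ _).trans (mul_le_mul h2 h3 (norm_nonneg _) hL0)
        rw [e2]
        linarith [norm_add_le ((memory G ρ u s - memory G ρ v s) * truncate (u s))
          (memory G ρ v s * (truncate (u s) - truncate (v s)))]
      rw [e, norm_neg, norm_smul, Real.norm_of_nonneg zero_le_two]
      have := norm_intervalIntegral_le_of_norm_le_Ioo (g := fun s => 3 * L * b * s ^ n)
        (f := fun s => P (t - s) * (forcing G ρ u s - forcing G ρ v s)) ht.1.le
        (Continuous.intervalIntegrable (by fun_prop) _ _) fun s hs =>
          hP.norm_mul_le (F := fun s => forcing G ρ u s - forcing G ρ v s) (sub_pos.2 hs.2)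
            (hdiff s ⟨hs.1, hs.2.le.trans ht.2⟩)
      rw [intervalIntegral.integral_const_mul, integral_pow, zero_pow (Nat.succ_ne_zero n),
        sub_zero] at this
      refine (mul_le_mul_of_nonneg_left this zero_le_two).trans (le_of_eq ?_)
      ring
  · obtain ⟨w, hw, hfix⟩ := hfp
    set W : ℝ → 𝓐 := fun t => if 0 < t then w t else 1
    have hW0 : W 0 = 1 := if_neg (lt_irrefl 0)
    have hWp : ∀ s, 0 < s → W s = w s := fun s hs => if_pos hs
    refine ⟨W, hw.congr hWp, fun t ht => ?_⟩
    rcases ht.eq_or_lt with rfl | ht0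
    · rw [hW0, convolve_zero, hP.zero, smul_zero, sub_zero]
    · rw [hWp t ht0, ← hfix t ht0]
      congr 2
      refine intervalIntegral_congr_Ioo ht fun s hs => ?_
      simp only [forcing, memory]
      rw [hWp s hs.1]
      congr 2
      exact intervalIntegral_congr_Ioo hs.1.le fun r hr => by simp only [hWp r hr.1]

theorem IsHeatSemigroup.locallyHolderHalf (hP : IsHeatSemigroup R P K) : LocallyHolderHalf P := by
  intro a T ha
  refine ⟨2 * a ^ (-(1 / 2) : ℝ), by positivity, ?_⟩
  have key : ∀ s t, a ≤ s → s ≤ t → ‖P t - P s‖ ≤ 2 * a ^ (-(1 / 2) : ℝ) * √(t - s) := by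
    intro s t hs hst
    have h := hP.norm_sub_le (ha.trans_le hs) hst
    have h2 : s ^ (-(1 / 2) : ℝ) ≤ a ^ (-(1 / 2) : ℝ) :=
      Real.rpow_le_rpow_of_nonpos ha hs (by norm_num)
    calc ‖P t - P s‖ ≤ 2 * √(t - s) * s ^ (-(1 / 2) : ℝ) := h
      _ ≤ 2 * √(t - s) * a ^ (-(1 / 2) : ℝ) := by gcongr
      _ = _ := by ring
  intro s hs t ht
  rcases le_total s t with h | h
  · rw [abs_of_nonneg (sub_nonneg.2 h)]
    exact key s t hs.1 h
  · rw [norm_sub_rev, abs_of_nonpos (sub_nonpos.2 h), neg_sub]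
    exact key t s ht.1 h

theorem LipschitzOnUnitBall.locallyHolderHalf_forcing (hG : LipschitzOnUnitBall G c)
    (hρ : Continuous ρ) (hu : ContinuousOn u (Ioi 0)) (hH : LocallyHolderHalf u) :
    LocallyHolderHalf (forcing G ρ u) := by
  intro a T ha
  obtain ⟨L, hL0, hL⟩ := hH a T ha
  obtain ⟨L1, hL10, hL1⟩ := hG.exists_norm_memory_sub_le hρ hu T
  obtain ⟨L2, hL20, hL2, -⟩ := hG.exists_norm_memory_le hρ T
  refine ⟨L1 * √|T| + L2 * (2 * L), by positivity, fun s hs t ht => ?_⟩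
  have hs' : s ∈ Icc 0 T := ⟨ha.le.trans hs.1, hs.2⟩
  have ht' : t ∈ Icc 0 T := ⟨ha.le.trans ht.1, ht.2⟩
  have e2 : forcing G ρ u t - forcing G ρ u s
      = (memory G ρ u t - memory G ρ u s) * truncate (u t)
        + memory G ρ u s * (truncate (u t) - truncate (u s)) := by
    simp only [forcing]; noncomm_ring
  have hsq : |t - s| ≤ √|T| * √|t - s| := by
    have h1 : √|t - s| ≤ √|T| := Real.sqrt_le_sqrt (by
      rw [abs_le]
      constructor <;> linarith [hs'.1, hs'.2, ht'.1, ht'.2, le_abs_self T])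
    calc |t - s| = √|t - s| * √|t - s| := (Real.mul_self_sqrt (abs_nonneg _)).symm
      _ ≤ _ := by gcongr
  have h4 : ‖(memory G ρ u t - memory G ρ u s) * truncate (u t)‖ ≤ L1 * (√|T| * √|t - s|) * 1 :=
    (norm_mul_le _ _).trans (mul_le_mul ((hL1 s hs' t ht').trans
      (mul_le_mul_of_nonneg_left hsq hL10)) (norm_truncate_le _) (norm_nonneg _) (by positivity))
  have h5 : ‖memory G ρ u s * (truncate (u t) - truncate (u s))‖
      ≤ L2 * (2 * (L * √|t - s|)) :=
    (norm_mul_le _ _).trans (mul_le_mul (hL2 u s hs') ((norm_truncate_sub_le _ _).trans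
      (mul_le_mul_of_nonneg_left (hL s hs t ht) zero_le_two)) (norm_nonneg _) hL20)
  rw [e2]
  linarith [norm_add_le ((memory G ρ u t - memory G ρ u s) * truncate (u t))
    (memory G ρ u s * (truncate (u t) - truncate (u s)))]

/-- Mild solutions are continuously differentiable in norm for `t > 0`. -/
theorem IsHeatSemigroup.mild_solution_regular [CompleteSpace 𝓐] (hP : IsHeatSemigroup R P K)
    (hG : LipschitzOnUnitBall G c) (hρ : Continuous ρ) {W : ℝ → 𝓐} (hW : ContinuousOn W (Ioi 0))
    (h : ∀ t, 0 ≤ t → W t = P t - (2 : ℝ) • convolve P (forcing G ρ W) t) :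
    ∃ W' : ℝ → 𝓐, ∀ t, 0 < t → HasDerivAt W (W' t) t ∧ ContinuousAt W' t ∧
      R * W' t = -((2 : ℝ) • ((1 - R) * W t)) - (2 : ℝ) • (R * forcing G ρ W t) := by
  have hF := hG.locallyBoundedContinuous_forcing hρ hW
  have hWH : LocallyHolderHalf W := by
    intro a T ha
    obtain ⟨L1, h10, h1⟩ := hP.locallyHolderHalf a T ha
    obtain ⟨L2, h20, h2⟩ := hP.exists_norm_convolve_sub_le hF T
    refine ⟨L1 + 2 * L2, by positivity, fun s hs t ht => ?_⟩
    have hs' : s ∈ Icc 0 T := ⟨ha.le.trans hs.1, hs.2⟩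
    have ht' : t ∈ Icc 0 T := ⟨ha.le.trans ht.1, ht.2⟩
    have e : W t - W s = (P t - P s)
        - (2 : ℝ) • (convolve P (forcing G ρ W) t - convolve P (forcing G ρ W) s) := by
      rw [h t ht'.1, h s hs'.1, smul_sub]; abel
    have h3 : ‖(2 : ℝ) • (convolve P (forcing G ρ W) t - convolve P (forcing G ρ W) s)‖
        ≤ 2 * (L2 * √|t - s|) := by
      rw [norm_smul, Real.norm_of_nonneg zero_le_two]
      exact mul_le_mul_of_nonneg_left (h2 s hs' t ht') zero_le_two
    rw [e]
    linarith [_root_.norm_sub_le (P t - P s)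
      ((2 : ℝ) • (convolve P (forcing G ρ W) t - convolve P (forcing G ρ W) s)), h1 s hs t ht]
  have hH := hG.locallyHolderHalf_forcing hρ hW hWH
  refine ⟨fun t => (-2 : ℝ) • K t - (2 : ℝ) • convolveDeriv P K (forcing G ρ W) t,
    fun t ht => ⟨?_, ?_, ?_⟩⟩
  · refine ((hP.hasDerivAt t ht).sub
      ((hP.hasDerivAt_convolve hF hH ht).const_smul (2 : ℝ))).congr_of_eventuallyEq ?_
    filter_upwards [lt_mem_nhds ht] with s hs using h s hs.le
  · exact ((hP.continuousAt_gen t ht).const_smul _).sub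
      ((hP.continuousAt_convolveDeriv hF hH ht).const_smul _)
  · rw [h t ht.le, mul_sub, mul_smul_comm, mul_smul_comm, hP.mul_gen t ht,
      hP.mul_convolveDeriv hF hH ht, mul_sub, mul_smul_comm, neg_smul, smul_sub, smul_sub]
    abel

end Nonlinear

section Hilbert

variable {H : Type*} [NormedAddCommGroup H] [InnerProductSpace ℂ H]

theorem HasDerivAt.op_apply {X : ℝ → H →L[ℂ] H} {X' : H →L[ℂ] H} {u : ℝ → H} {u' : H} {t : ℝ}
    (hX : HasDerivAt X X' t) (hu : HasDerivAt u u' t) :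
    HasDerivAt (fun s => X s (u s)) (X' (u t) + X t u') t :=
  ((ContinuousLinearMap.restrictScalarsL ℂ H H ℝ ℝ).hasFDerivAt.comp_hasDerivAt t hX).clm_apply hu

theorem HasDerivAt.op_apply_const {X : ℝ → H →L[ℂ] H} {X' : H →L[ℂ] H} {t : ℝ}
    (hX : HasDerivAt X X' t) (x : H) : HasDerivAt (fun s => X s x) (X' x) t := by
  simpa using hX.op_apply (hasDerivAt_const t x)

theorem hasDerivAt_norm_sq {w : ℝ → H} {w' : H} {t : ℝ} (h : HasDerivAt w w' t) :
    HasDerivAt (fun s => ‖w s‖ ^ 2) (2 * (⟪w t, w'⟫_ℂ).re) t := by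
  have h1 := (h.inner ℂ h)
  have h2 := Complex.reCLM.hasFDerivAt.comp_hasDerivAt t h1
  have e : (fun s => ‖w s‖ ^ 2) = Complex.reCLM ∘ fun s => ⟪w s, w s⟫_ℂ := by
    funext s
    exact (inner_self_eq_norm_sq (𝕜 := ℂ) (w s)).symm
  rw [e]
  have h3 : (⟪w', w t⟫_ℂ).re = (⟪w t, w'⟫_ℂ).re := inner_re_symm (𝕜 := ℂ) w' (w t)
  have h4 : Complex.reCLM (⟪w t, w'⟫_ℂ + ⟪w', w t⟫_ℂ) = 2 * (⟪w t, w'⟫_ℂ).re := by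
    rw [Complex.reCLM_apply, Complex.add_re, h3]; ring
  rwa [h4] at h2

/-- Solutions of `W' = -2 (B W + F)` with `B ≥ 0`, `Re ⟪W φ, F φ⟫ ≥ 0` and `W 0 = 1` are
contractions; the equation is expressed through `R = (B + 1)⁻¹`. -/
theorem norm_le_one_of_dissipative {R : H →L[ℂ] H} (hR : ∀ y, ‖R y‖ ^ 2 ≤ (⟪R y, y⟫_ℂ).re)
    {W W' F : ℝ → H →L[ℂ] H} (h0 : W 0 = 1)
    (hc : ∀ φ, ContinuousOn (fun t => W t φ) (Ici 0)) (hd : ∀ t, 0 < t → HasDerivAt W (W' t) t)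
    (heq : ∀ t, 0 < t → R * W' t = -((2 : ℝ) • ((1 - R) * W t)) - (2 : ℝ) • (R * F t))
    (hF : ∀ t, 0 < t → ∀ φ, 0 ≤ (⟪W t φ, F t φ⟫_ℂ).re) {t : ℝ} (ht : 0 ≤ t) : ‖W t‖ ≤ 1 := by
  refine ContinuousLinearMap.opNorm_le_bound _ zero_le_one fun φ => ?_
  have hder : ∀ s, 0 < s → HasDerivAt (fun s => ‖W s φ‖ ^ 2) (2 * (⟪W s φ, W' s φ⟫_ℂ).re) s :=
    fun s hs => hasDerivAt_norm_sq ((hd s hs).op_apply_const φ)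
  have hneg : ∀ s, 0 < s → 2 * (⟪W s φ, W' s φ⟫_ℂ).re ≤ 0 := by
    intro s hs
    set w := W s φ
    set w' := W' s φ
    set f := F s φ
    set y := w - (2⁻¹ : ℝ) • w' - f with hy
    have e : R y = w := by
      have h1 : R w' = -((2 : ℝ) • (w - R w)) - (2 : ℝ) • R f := by
        have := congrArg (fun X : H →L[ℂ] H => X φ) (heq s hs)
        simpa using this
      have h2 : R ((2⁻¹ : ℝ) • w') = (2⁻¹ : ℝ) • R w' := R.map_smul_of_tower _ _
      rw [hy, map_sub, map_sub, h2, h1]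
      module
    have h1 := hR y
    rw [e] at h1
    have h2 : (⟪w, y⟫_ℂ).re = ‖w‖ ^ 2 - 2⁻¹ * (⟪w, w'⟫_ℂ).re - (⟪w, f⟫_ℂ).re := by
      rw [hy, inner_sub_right, inner_sub_right, ← Complex.coe_smul, inner_smul_right,
        Complex.sub_re, Complex.sub_re, Complex.re_ofReal_mul]
      congr 2
      exact inner_self_eq_norm_sq (𝕜 := ℂ) w
    have h3 : 0 ≤ (⟪w, f⟫_ℂ).re := hF s hs φ
    linarith
  have hanti : AntitoneOn (fun s => ‖W s φ‖ ^ 2) (Ici 0) := by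
    refine antitoneOn_of_deriv_nonpos (convex_Ici 0) ((hc φ).norm.pow 2) ?_ ?_
    · rw [interior_Ici]
      exact fun s hs => (hder s hs).differentiableAt.differentiableWithinAt
    · rw [interior_Ici]
      intro s hs
      rw [(hder s hs).deriv]
      exact hneg s hs
  have := hanti self_mem_Ici ht ht
  simp only [h0, one_apply_eq_self] at this
  rw [one_mul]
  exact (sq_le_sq₀ (norm_nonneg _) (norm_nonneg _)).1 this

theorem continuousOn_apply_of_dense {X : ℝ → H →L[ℂ] H} {S : Set ℝ} {M : ℝ} {𝒟 : Set H}
    (hM : ∀ t ∈ S, ‖X t‖ ≤ M) (hD : Dense 𝒟)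
    (h : ∀ x ∈ 𝒟, ContinuousOn (fun t => X t x) S) (φ : H) :
    ContinuousOn (fun t => X t φ) S := by
  intro t ht
  have hM0 : 0 ≤ M := (norm_nonneg _).trans (hM t ht)
  rw [Metric.continuousWithinAt_iff']
  intro ε hε
  obtain ⟨x, hx, hxφ⟩ := Metric.mem_closure_iff.1 (hD φ) (ε / (3 * (M + 1))) (by positivity)
  have h1 := Metric.continuousWithinAt_iff'.1 (h x hx t ht) (ε / 3) (by positivity)
  have hb : ∀ s ∈ S, ‖X s φ - X s x‖ ≤ ε / 3 := by
    intro s hs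
    rw [← map_sub]
    calc ‖X s (φ - x)‖ ≤ M * ‖φ - x‖ := (X s).le_of_opNorm_le (hM s hs) _
      _ ≤ (M + 1) * (ε / (3 * (M + 1))) := by
          rw [← dist_eq_norm]
          exact mul_le_mul (by linarith) hxφ.le dist_nonneg (by linarith)
      _ = ε / 3 := by field_simp
  filter_upwards [h1, self_mem_nhdsWithin] with s hs hsS
  rw [dist_eq_norm] at hs ⊢
  have e : X s φ - X t φ = (X s φ - X s x) + (X s x - X t x) - (X t φ - X t x) := by abel
  rw [e]
  linarith [norm_sub_le ((X s φ - X s x) + (X s x - X t x)) (X t φ - X t x),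
    norm_add_le (X s φ - X s x) (X s x - X t x), hb s hsS, hb t ht]

variable [CompleteSpace H]

theorem continuousOn_heat_apply {R : H →L[ℂ] H} (hs : spectrum ℝ R ⊆ Icc 0 1)
    (hR : IsSelfAdjoint R) (hd : DenseRange R) (φ : H) :
    ContinuousOn (fun t => heat R t φ) (Ici 0) := by
  have hb : ∀ t : ℝ, 0 < t → ‖heat R t‖ ≤ 1 := fun t ht => by
    simpa [heat_of_pos R ht] using norm_heatOp_le hs 0 ht
  have h0 : heat R 0 = 1 := if_neg (lt_irrefl 0)
  refine continuousOn_apply_of_dense (M := 1) (𝒟 := range R) (fun t ht => ?_) hd ?_ φ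
  · rcases (mem_Ici.1 ht).eq_or_lt with rfl | ht0
    · rw [h0]; exact ContinuousLinearMap.norm_id_le
    · exact hb t ht0
  · rintro _ ⟨y, rfl⟩ t ht
    have e : ∀ s, heat R s (R y) = (R * heat R s) y := fun s => by
      rw [(commute_heat hR s).eq]; rfl
    simp only [e]
    rcases (mem_Ici.1 ht).eq_or_lt with rfl | ht0
    · rw [ContinuousWithinAt, h0, mul_one, tendsto_iff_norm_sub_tendsto_zero]
      have h2 : Filter.Tendsto (fun s : ℝ => 2 * s * ‖y‖) (𝓝[Ici 0] 0) (𝓝 0) := by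
        have : Continuous fun s : ℝ => 2 * s * ‖y‖ := by fun_prop
        simpa [ContinuousWithinAt] using this.continuousWithinAt (s := Ici 0) (x := 0)
      refine squeeze_zero' (Filter.Eventually.of_forall fun _ => norm_nonneg _) ?_ h2
      filter_upwards [self_mem_nhdsWithin] with s hs0
      rcases (mem_Ici.1 hs0).eq_or_lt with rfl | hs1
      · simp [h0]
      · rw [← sub_apply]
        refine ContinuousLinearMap.le_of_opNorm_le _ ?_ y
        rw [heat_of_pos R hs1]
        exact norm_mul_heatOp_sub_le hs hR hs1
    · have h3 : HasDerivAt (heat R) ((-2 : ℝ) • heatOp R 1 t) t :=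
        (hasDerivAt_heatOp hs 0 ht0).congr_of_eventuallyEq (by
          filter_upwards [lt_mem_nhds ht0] with s h using heat_of_pos R h)
      exact ((h3.const_mul R).op_apply_const y).continuousAt.continuousWithinAt

namespace ComplexConjugation

variable (C : ComplexConjugation H)

theorem norm_map (f : H) : ‖C.toFun f‖ = ‖f‖ := by
  have h := C.inner_map_map f f
  rw [inner_self_eq_norm_sq_to_K, inner_self_eq_norm_sq_to_K] at h
  have h' : ‖C.toFun f‖ ^ 2 = ‖f‖ ^ 2 := by exact_mod_cast h
  exact (sq_eq_sq₀ (norm_nonneg _) (norm_nonneg _)).1 h'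

theorem inner_map_left (f g : H) : ⟪C.toFun f, g⟫_ℂ = ⟪C.toFun g, f⟫_ℂ := by
  conv_lhs => rw [← C.involutive g]
  rw [C.inner_map_map]

theorem map_real_smul (c : ℝ) (f : H) : C.toFun (c • f) = c • C.toFun f := by
  rw [← Complex.coe_smul, LinearMap.map_smulₛₗ, Complex.conj_ofReal, Complex.coe_smul]

/-- The conjugation as a continuous real-linear map. -/
noncomputable def toCLM : H →L[ℝ] H :=
  LinearMap.mkContinuous
    { toFun := C.toFun, map_add' := map_add C.toFun, map_smul' := C.map_real_smul } 1
    fun f => by simpa using (C.norm_map f).le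

theorem continuous : Continuous C.toFun := C.toCLM.continuous

/-- The transpose `C X* C` of a bounded operator. -/
noncomputable def boundedTranspose (X : H →L[ℂ] H) : H →L[ℂ] H :=
  LinearMap.mkContinuous
    { toFun := fun f => C.toFun (ContinuousLinearMap.adjoint X (C.toFun f))
      map_add' := fun f g => by simp
      map_smul' := fun c f => by simp [LinearMap.map_smulₛₗ] } ‖X‖
    fun f => by
      have := (ContinuousLinearMap.adjoint X).le_opNorm (C.toFun f)
      rw [LinearIsometryEquiv.norm_map, C.norm_map] at this
      simpa [C.norm_map] using this

theorem boundedTranspose_apply (X : H →L[ℂ] H) (f : H) :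
    C.boundedTranspose X f = C.toFun (ContinuousLinearMap.adjoint X (C.toFun f)) := rfl

theorem norm_boundedTranspose_le (X : H →L[ℂ] H) : ‖C.boundedTranspose X‖ ≤ ‖X‖ :=
  LinearMap.mkContinuous_norm_le _ (norm_nonneg _) _

theorem adjoint_boundedTranspose_apply (X : H →L[ℂ] H) (f : H) :
    ContinuousLinearMap.adjoint (C.boundedTranspose X) f = C.toFun (X (C.toFun f)) := by
  refine ext_inner_right ℂ fun g => ?_
  rw [ContinuousLinearMap.adjoint_inner_left, boundedTranspose_apply, C.inner_map_left,
    ← inner_conj_symm, C.inner_map_left, inner_conj_symm, ContinuousLinearMap.adjoint_inner_left,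
    ← inner_conj_symm]

/-- The transpose of bounded operators as a continuous real-linear map. -/
noncomputable def transposeCLM : (H →L[ℂ] H) →L[ℝ] (H →L[ℂ] H) :=
  LinearMap.mkContinuous
    { toFun := C.boundedTranspose
      map_add' := fun X Y => by ext f; simp [boundedTranspose_apply]
      map_smul' := fun c X => by
        ext f
        simp only [boundedTranspose_apply, RingHom.id_apply, smul_apply]
        rw [← C.map_real_smul, ← Complex.coe_smul, LinearIsometryEquiv.map_smulₛₗ,
          Complex.conj_ofReal]
        rfl } 1
    fun X => by simpa using C.norm_boundedTranspose_le X

theorem transposeCLM_apply (X : H →L[ℂ] H) : C.transposeCLM X = C.boundedTranspose X := rfl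

end ComplexConjugation

end Hilbert

section BoundedFlow

variable {H : Type*} [NormedAddCommGroup H] [InnerProductSpace ℂ H] [CompleteSpace H]

/-- The bilinear expression `X D₀ Xᵀ`. -/
noncomputable def ComplexConjugation.sandwich (C : ComplexConjugation H) (D₀ X : H →L[ℂ] H) :
    H →L[ℂ] H := X * D₀ * C.boundedTranspose X

/-- `Z Z*` for `Z = X D₀ Xᵀ`. -/
noncomputable def ComplexConjugation.gram (C : ComplexConjugation H) (D₀ X : H →L[ℂ] H) :
    H →L[ℂ] H := C.sandwich D₀ X * star (C.sandwich D₀ X)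

theorem ComplexConjugation.lipschitzOnUnitBall_gram (C : ComplexConjugation H) (D₀ : H →L[ℂ] H) :
    LipschitzOnUnitBall (C.gram D₀) (4 * ‖D₀‖ ^ 2) := by
  have b1 : ∀ x : H →L[ℂ] H, ‖x‖ ≤ 1 → ‖C.sandwich D₀ x‖ ≤ ‖D₀‖ := fun x hx => by
    have h := (C.norm_boundedTranspose_le x).trans hx
    calc ‖x * D₀ * C.boundedTranspose x‖ ≤ ‖x‖ * ‖D₀‖ * ‖C.boundedTranspose x‖ := norm_mul₃_le
      _ ≤ 1 * ‖D₀‖ * 1 := by gcongr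
      _ = ‖D₀‖ := by ring
  have b2 : ∀ x y : H →L[ℂ] H, ‖x‖ ≤ 1 → ‖y‖ ≤ 1 →
      ‖C.sandwich D₀ x - C.sandwich D₀ y‖ ≤ 2 * ‖D₀‖ * ‖x - y‖ := fun x y hx hy => by
    have e : C.sandwich D₀ x - C.sandwich D₀ y
        = (x - y) * D₀ * C.boundedTranspose x + y * D₀ * C.boundedTranspose (x - y) := by
      simp only [ComplexConjugation.sandwich, ← C.transposeCLM_apply, map_sub]
      noncomm_ring
    have h1 := (C.norm_boundedTranspose_le x).trans hx
    have h2 := C.norm_boundedTranspose_le (x - y)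
    have h3 : ‖(x - y) * D₀ * C.boundedTranspose x‖ ≤ ‖x - y‖ * ‖D₀‖ * 1 :=
      norm_mul₃_le.trans (by gcongr)
    have h4 : ‖y * D₀ * C.boundedTranspose (x - y)‖ ≤ 1 * ‖D₀‖ * ‖x - y‖ :=
      norm_mul₃_le.trans (by gcongr)
    rw [e]
    linarith [norm_add_le ((x - y) * D₀ * C.boundedTranspose x)
      (y * D₀ * C.boundedTranspose (x - y))]
  refine ⟨fun x hx => ?_, fun x y hx hy => ?_⟩
  · refine (norm_mul_le _ _).trans ?_
    rw [norm_star]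
    have := mul_le_mul (b1 x hx) (b1 x hx) (norm_nonneg _) (norm_nonneg _)
    nlinarith [sq_nonneg ‖D₀‖]
  · have e : C.gram D₀ x - C.gram D₀ y
        = (C.sandwich D₀ x - C.sandwich D₀ y) * star (C.sandwich D₀ x)
          + C.sandwich D₀ y * star (C.sandwich D₀ x - C.sandwich D₀ y) := by
      simp only [ComplexConjugation.gram, star_sub]
      noncomm_ring
    have h1 := b1 x hx
    have h2 := b1 y hy
    have h3 := b2 x y hx hy
    have h4 : ‖(C.sandwich D₀ x - C.sandwich D₀ y) * star (C.sandwich D₀ x)‖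
        ≤ 2 * ‖D₀‖ * ‖x - y‖ * ‖D₀‖ := by
      refine (norm_mul_le _ _).trans ?_
      rw [norm_star]
      gcongr
    have h5 : ‖C.sandwich D₀ y * star (C.sandwich D₀ x - C.sandwich D₀ y)‖
        ≤ ‖D₀‖ * (2 * ‖D₀‖ * ‖x - y‖) := by
      refine (norm_mul_le _ _).trans ?_
      rw [norm_star]
      gcongr
    rw [e]
    refine (norm_add_le _ _).trans ((add_le_add h4 h5).trans (le_of_eq ?_))
    ring

theorem memory_nonneg {G : (H →L[ℂ] H) → H →L[ℂ] H} (hG : ∀ x, 0 ≤ G x) {ρ : ℝ → ℝ}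
    (hρ : ∀ s, 0 ≤ ρ s) (u : ℝ → H →L[ℂ] H) {t : ℝ} (ht : 0 ≤ t) : 0 ≤ memory G ρ u t := by
  rw [memory, intervalIntegral.integral_of_le ht]
  exact integral_nonneg fun s => smul_nonneg (hρ s) (hG _)

/-- The integral `∫₀ᵗ ρ s G(W s) ds`. -/
noncomputable def accumulated (G : (H →L[ℂ] H) → H →L[ℂ] H) (ρ : ℝ → ℝ) (W : ℝ → H →L[ℂ] H)
    (t : ℝ) : H →L[ℂ] H := ∫ s in (0 : ℝ)..t, ρ s • G (W s)

/-- The evolution operators `W' = -2 (B + Δ) W`, `Δ t = ∫₀ᵗ ρ s G(W s) ds`, where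
`R = (B + 1)⁻¹`. -/
structure IsEvolution (R : H →L[ℂ] H) (Δ W W' : ℝ → H →L[ℂ] H) : Prop where
  zero : W 0 = 1
  norm_le : ∀ t, 0 ≤ t → ‖W t‖ ≤ 1
  strong : ∀ φ, ContinuousOn (fun t => W t φ) (Ici 0)
  strong_star : ∀ φ, ContinuousOn (fun t => star (W t) φ) (Ici 0)
  hasDerivAt : ∀ t, 0 < t → HasDerivAt W (W' t) t
  continuousAt_deriv : ∀ t, 0 < t → ContinuousAt W' t
  mul_deriv : ∀ t, 0 < t →
    R * W' t = -((2 : ℝ) • ((1 - R) * W t)) - (2 : ℝ) • (R * (Δ t * W t))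

theorem exists_isEvolution {R : H →L[ℂ] H} (hs : spectrum ℝ R ⊆ Icc 0 1) (hR : IsSelfAdjoint R)
    (hd : DenseRange R) (hi : ∀ y, R y = 0 → y = 0) (hq : ∀ y, ‖R y‖ ^ 2 ≤ (⟪R y, y⟫_ℂ).re)
    {G : (H →L[ℂ] H) → H →L[ℂ] H} {c : ℝ} (hG : LipschitzOnUnitBall G c) (hG0 : ∀ x, 0 ≤ G x)
    {ρ : ℝ → ℝ} (hρ : Continuous ρ) (hρ0 : ∀ s, 0 ≤ ρ s) :
    ∃ W W' : ℝ → H →L[ℂ] H, IsEvolution R (accumulated G ρ W) W W' ∧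
      ∀ t, 0 ≤ t → 0 ≤ accumulated G ρ W t := by
  have hP : IsHeatSemigroup R (heat R) (heatOp R 1) := isHeatSemigroup_heat hs hR fun x hx => by
    ext φ
    exact hi _ (congrArg (fun X : H →L[ℂ] H => X φ) hx)
  obtain ⟨W, hW, hWeq⟩ := hP.exists_mild_solution hG hρ
  obtain ⟨W', hW'⟩ := hP.mild_solution_regular hG hρ hW hWeq
  have hcV := hP.continuousOn_convolve (hG.locallyBoundedContinuous_forcing hρ hW)
  have hW0 : W 0 = 1 := by
    rw [hWeq 0 le_rfl, convolve_zero, smul_zero, sub_zero, hP.zero]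
  have happ : ∀ φ, Continuous fun X : H →L[ℂ] H => X φ := fun φ =>
    (ContinuousLinearMap.apply ℂ H φ).continuous
  have hstrong : ∀ φ, ContinuousOn (fun t => W t φ) (Ici 0) := by
    intro φ
    refine ((continuousOn_heat_apply hs hR hd φ).sub
      (((happ φ).comp_continuousOn hcV).const_smul (2 : ℝ))).congr fun t ht => ?_
    rw [hWeq t ht]; rfl
  have hstar : ∀ φ, ContinuousOn (fun t => star (W t) φ) (Ici 0) := by
    intro φ
    refine ((continuousOn_heat_apply hs hR hd φ).sub
      (((happ φ).comp_continuousOn (continuous_star.comp_continuousOn hcV)).const_smul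
        (2 : ℝ))).congr fun t ht => ?_
    simp only [hWeq t ht, star_sub, star_smul, star_trivial, (isSelfAdjoint_heat R t).star_eq]
    rfl
  have hmem : ∀ t, 0 ≤ t → 0 ≤ memory G ρ W t := fun t ht => memory_nonneg hG0 hρ0 W ht
  have hnorm : ∀ t, 0 ≤ t → ‖W t‖ ≤ 1 := fun t ht => by
    refine norm_le_one_of_dissipative hq hW0 hstrong (fun s h => (hW' s h).1)
      (fun s h => (hW' s h).2.2) (fun s h φ => ?_) ht
    have h1 := ((ContinuousLinearMap.nonneg_iff_isPositive _).1
      (hmem s h.le)).re_inner_nonneg_right (W s φ)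
    have h2 : forcing G ρ W s φ = (max 1 ‖W s‖)⁻¹ • memory G ρ W s (W s φ) := by
      simp only [forcing, truncate]
      exact (memory G ρ W s).map_smul_of_tower _ _
    rw [h2, ← Complex.coe_smul, inner_smul_right, Complex.re_ofReal_mul]
    exact mul_nonneg (inv_nonneg.2 (zero_le_one.trans (le_max_left _ _))) h1
  have hacc : ∀ t, 0 ≤ t → accumulated G ρ W t = memory G ρ W t := fun t ht =>
    intervalIntegral_congr_Ioo ht fun s hs => by
      rw [truncate_of_norm_le_one (hnorm s hs.1.le)]
  refine ⟨W, W', ⟨hW0, hnorm, hstrong, hstar, fun t ht => (hW' t ht).1,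
    fun t ht => (hW' t ht).2.1, fun t ht => ?_⟩, fun t ht => hacc t ht ▸ hmem t ht⟩
  rw [(hW' t ht).2.2, forcing, truncate_of_norm_le_one (hnorm t ht.le), hacc t ht.le]

end BoundedFlow

section Unbounded

variable {H : Type*} [NormedAddCommGroup H] [InnerProductSpace ℂ H]

/-- `R = (A + μ + 1)⁻¹` for a self-adjoint `A ≥ -μ`. -/
structure IsShiftedResolvent [CompleteSpace H] (A : H →ₗ.[ℂ] H) (μ : ℝ) (R : H →L[ℂ] H) :
    Prop where
  isSelfAdjoint : IsSelfAdjoint R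
  apply_eq : ∀ y, ∃ h : R y ∈ A.domain, A ⟨R y, h⟩ = y - (μ + 1) • R y
  apply_apply : ∀ x : A.domain, R (A x + (μ + 1) • (x : H)) = x
  norm_sq_le : ∀ y, ‖R y‖ ^ 2 ≤ (⟪R y, y⟫_ℂ).re

variable [CompleteSpace H] {A : H →ₗ.[ℂ] H}

theorem IsSelfAdjoint.inner_symm (hA : IsSelfAdjoint A) (x y : A.domain) :
    ⟪A x, (y : H)⟫_ℂ = ⟪(x : H), A y⟫_ℂ := by
  have h := LinearPMap.adjoint_isFormalAdjoint hA.dense_domain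
  rw [LinearPMap.isSelfAdjoint_def.1 hA] at h
  exact h x y

theorem IsSelfAdjoint.exists_apply_eq (hA : IsSelfAdjoint A) {z w : H}
    (h : ∀ x : A.domain, ⟪w, (x : H)⟫_ℂ = ⟪z, A x⟫_ℂ) : ∃ hz : z ∈ A.domain, A ⟨z, hz⟩ = w := by
  have : ∃ hz : z ∈ A.adjoint.domain, A.adjoint ⟨z, hz⟩ = w :=
    ⟨LinearPMap.mem_adjoint_domain_of_exists z ⟨w, h⟩,
      LinearPMap.adjoint_apply_eq hA.dense_domain _ h⟩
  rwa [LinearPMap.isSelfAdjoint_def.1 hA] at this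

theorem exists_isShiftedResolvent (hA : IsSelfAdjoint A) {μ : ℝ} (hμ : LowerBoundedBy A (-μ)) :
    ∃ R, IsShiftedResolvent A μ R := by
  set T : A.domain →ₗ[ℂ] H := A.toFun + ((μ + 1 : ℝ) : ℂ) • A.domain.subtype
  have hT : ∀ x : A.domain, T x = A x + (μ + 1) • (x : H) := fun x => by
    change A x + ((μ + 1 : ℝ) : ℂ) • (x : H) = _
    rw [Complex.coe_smul]
  have hq : ∀ x : A.domain, ‖(x : H)‖ ^ 2 ≤ (⟪(x : H), T x⟫_ℂ).re := fun x => by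
    have h2 : (⟪(x : H), (x : H)⟫_ℂ).re = ‖(x : H)‖ ^ 2 := inner_self_eq_norm_sq (𝕜 := ℂ) (x : H)
    rw [hT, inner_add_right, ← Complex.coe_smul, inner_smul_right, Complex.add_re,
      Complex.re_ofReal_mul, h2]
    linarith [hμ x]
  have hn : ∀ x : A.domain, ‖(x : H)‖ ≤ ‖T x‖ := fun x => by
    have h1 := (hq x).trans ((Complex.re_le_norm _).trans (norm_inner_le_norm _ _))
    rcases (norm_nonneg (x : H)).eq_or_lt with h | h
    · rw [← h]; exact norm_nonneg _
    · rw [sq] at h1; exact le_of_mul_le_mul_left h1 h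
  have hinj : Function.Injective T := by
    rw [injective_iff_map_eq_zero]
    intro x hx
    have := hn x
    rw [hx, norm_zero] at this
    exact Subtype.ext (norm_le_zero_iff.1 this)
  have hclosed : IsClosed (LinearMap.range T : Set H) := by
    have hg : IsClosed (A.graph : Set (H × H)) := hA.isClosed
    have : CompleteSpace A.graph := hg.completeSpace_coe
    let S : A.graph →L[ℂ] H :=
      (ContinuousLinearMap.snd ℂ H H + ((μ + 1 : ℝ) : ℂ) • ContinuousLinearMap.fst ℂ H H).comp
        A.graph.subtypeL
    have hS : ∀ (x : A.domain) (h : ((x : H), A x) ∈ A.graph), S ⟨_, h⟩ = T x := fun x h => rfl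
    have hanti : AntilipschitzWith (Real.toNNReal (1 + |μ + 1|)) S := by
      refine AddMonoidHomClass.antilipschitz_of_bound S fun p => ?_
      obtain ⟨⟨p1, p2⟩, hp⟩ := p
      obtain ⟨x, hx1, hx2⟩ := (LinearPMap.mem_graph_iff A).1 hp
      simp only at hx1 hx2
      subst hx1 hx2
      rw [hS x hp, Real.coe_toNNReal _ (by positivity)]
      have h1 := hn x
      have h2 : ‖A x‖ ≤ ‖T x‖ + |μ + 1| * ‖(x : H)‖ := by
        have : A x = T x - (μ + 1) • (x : H) := by rw [hT]; abel
        rw [this]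
        refine (norm_sub_le _ _).trans ?_
        rw [norm_smul, Real.norm_eq_abs]
      have h3 : |μ + 1| * ‖(x : H)‖ ≤ |μ + 1| * ‖T x‖ := by gcongr
      have h4 : 0 ≤ |μ + 1| * ‖T x‖ := by positivity
      change max ‖(x : H)‖ ‖A x‖ ≤ _
      rw [add_mul, one_mul]
      exact max_le (by linarith) (by linarith)
    have := hanti.isClosed_range S.uniformContinuous
    convert this using 1
    ext y
    constructor
    · rintro ⟨x, rfl⟩
      exact ⟨⟨_, A.mem_graph x⟩, hS x _⟩
    · rintro ⟨⟨⟨p1, p2⟩, hp⟩, rfl⟩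
      obtain ⟨x, hx1, hx2⟩ := (LinearPMap.mem_graph_iff A).1 hp
      simp only at hx1 hx2
      subst hx1 hx2
      exact ⟨x, (hS x hp).symm⟩
  have hsurj : Function.Surjective T := by
    rw [← LinearMap.range_eq_top]
    have : CompleteSpace (LinearMap.range T) := hclosed.completeSpace_coe
    rw [← Submodule.orthogonal_eq_bot_iff, Submodule.eq_bot_iff]
    intro z hz
    have h1 : ∀ x : A.domain, ⟪-((μ + 1) • z), (x : H)⟫_ℂ = ⟪z, A x⟫_ℂ := fun x => by
      have h := (Submodule.mem_orthogonal' _ _).1 hz (T x) ⟨x, rfl⟩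
      rw [hT, inner_add_right, ← Complex.coe_smul, inner_smul_right] at h
      rw [inner_neg_left, ← Complex.coe_smul, inner_smul_left, Complex.conj_ofReal]
      exact (eq_neg_of_add_eq_zero_left h).symm
    obtain ⟨hzA, hz2⟩ := hA.exists_apply_eq h1
    have : T ⟨z, hzA⟩ = 0 := by rw [hT, hz2]; simp
    have h3 := hn ⟨z, hzA⟩
    rw [this, norm_zero] at h3
    exact norm_le_zero_iff.1 h3
  let e := LinearEquiv.ofBijective T ⟨hinj, hsurj⟩
  have he : ∀ y, T (e.symm y) = y := fun y => e.apply_symm_apply y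
  let R : H →L[ℂ] H := LinearMap.mkContinuous (A.domain.subtype ∘ₗ e.symm.toLinearMap) 1
    fun y => by
      have := hn (e.symm y)
      rw [he] at this
      simpa using this
  have hR : ∀ y, R y = e.symm y := fun y => rfl
  have hR2 : ∀ x : A.domain, R (T x) = x := fun x => by
    rw [hR]; congr 1; exact e.symm_apply_apply x
  refine ⟨R, ?_, fun y => ⟨(e.symm y).2, ?_⟩, fun x => by rw [← hT, hR2], fun y => ?_⟩
  · rw [ContinuousLinearMap.isSelfAdjoint_iff_isSymmetric]
    intro y z
    obtain ⟨x, rfl⟩ := hsurj y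
    obtain ⟨x', rfl⟩ := hsurj z
    change ⟪R (T x), T x'⟫_ℂ = ⟪T x, R (T x')⟫_ℂ
    rw [hR2, hR2, hT, hT, inner_add_right, inner_add_left, hA.inner_symm, ← Complex.coe_smul,
      ← Complex.coe_smul, inner_smul_left, inner_smul_right, Complex.conj_ofReal]
  · change A (e.symm y) = y - (μ + 1) • (e.symm y : H)
    have h1 := he y
    rw [hT] at h1
    exact eq_sub_of_add_eq h1
  · obtain ⟨x, rfl⟩ := hsurj y
    rw [hR2]
    exact hq x

namespace IsShiftedResolvent

variable {μ : ℝ} {R : H →L[ℂ] H}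

theorem eq_zero (hR : IsShiftedResolvent A μ R) {y : H} (hy : R y = 0) : y = 0 := by
  obtain ⟨h, h1⟩ := hR.apply_eq y
  have h2 : (⟨R y, h⟩ : A.domain) = 0 := Subtype.ext hy
  rw [h2, LinearPMap.map_zero, hy, smul_zero, sub_zero] at h1
  exact h1.symm

theorem denseRange (hA : IsSelfAdjoint A) (hR : IsShiftedResolvent A μ R) : DenseRange R :=
  hA.dense_domain.mono fun x hx => ⟨_, hR.apply_apply ⟨x, hx⟩⟩

theorem norm_le_one (hR : IsShiftedResolvent A μ R) : ‖R‖ ≤ 1 := by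
  refine ContinuousLinearMap.opNorm_le_bound _ zero_le_one fun y => ?_
  have h1 := (hR.norm_sq_le y).trans ((Complex.re_le_norm _).trans (norm_inner_le_norm _ _))
  rw [one_mul]
  rcases (norm_nonneg (R y)).eq_or_lt with h | h
  · rw [← h]; exact norm_nonneg _
  · rw [sq] at h1; exact le_of_mul_le_mul_left h1 h

theorem spectrum_subset (hR : IsShiftedResolvent A μ R) : spectrum ℝ R ⊆ Icc 0 1 := by
  have hpos : 0 ≤ R := by
    rw [ContinuousLinearMap.nonneg_iff_isPositive]
    refine ⟨ContinuousLinearMap.isSelfAdjoint_iff_isSymmetric.1 hR.isSelfAdjoint, fun y => ?_⟩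
    exact (sq_nonneg _).trans (hR.norm_sq_le y)
  intro r hr
  refine ⟨spectrum_nonneg_of_nonneg hpos hr, ?_⟩
  have h1 := spectrum.norm_le_norm_mul_of_mem hr
  have h2 : ‖(1 : H →L[ℂ] H)‖ ≤ 1 := ContinuousLinearMap.norm_id_le
  have h3 := mul_le_mul hR.norm_le_one h2 (norm_nonneg _) zero_le_one
  linarith [Real.le_norm_self r]

end IsShiftedResolvent

theorem mem_domain_transpose (C : ComplexConjugation H) (hA : IsSelfAdjoint A) {φ : H} :
    φ ∈ (C.transpose A).domain ↔ C.toFun φ ∈ A.domain := by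
  change C.toFun φ ∈ A.adjoint.domain ↔ _
  rw [LinearPMap.isSelfAdjoint_def.1 hA]

theorem addBounded_apply (Δ : H →L[ℂ] H) {x : H} (h : x ∈ (addBounded Δ A).domain)
    (h' : x ∈ A.domain) : addBounded Δ A ⟨x, h⟩ = Δ x + A ⟨x, h'⟩ := rfl

theorem exists_transpose_addBounded_eq (C : ComplexConjugation H) (hA : IsSelfAdjoint A)
    (Δ : H →L[ℂ] H) {φ : H} (h : C.toFun φ ∈ A.domain) :
    ∃ h' : φ ∈ (C.transpose (addBounded Δ A)).domain,
      C.transpose (addBounded Δ A) ⟨φ, h'⟩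
        = C.boundedTranspose Δ φ + C.toFun (A ⟨C.toFun φ, h⟩) := by
  have hd : Dense ((addBounded Δ A).domain : Set H) := hA.dense_domain
  have key : ∀ x : (addBounded Δ A).domain,
      ⟪ContinuousLinearMap.adjoint Δ (C.toFun φ) + A ⟨C.toFun φ, h⟩, (x : H)⟫_ℂ
        = ⟪C.toFun φ, addBounded Δ A x⟫_ℂ := by
    rintro ⟨x, hx⟩
    rw [addBounded_apply Δ hx hx, inner_add_left, inner_add_right, ContinuousLinearMap.adjoint_inner_left]
    congr 1
    exact hA.inner_symm ⟨_, h⟩ ⟨x, hx⟩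
  have hm : C.toFun φ ∈ (addBounded Δ A).adjoint.domain :=
    LinearPMap.mem_adjoint_domain_of_exists _ ⟨_, key⟩
  refine ⟨hm, ?_⟩
  change C.toFun ((addBounded Δ A).adjoint ⟨C.toFun φ, hm⟩) = _
  rw [LinearPMap.adjoint_apply_eq hd ⟨C.toFun φ, hm⟩ key, map_add]
  rfl

end Unbounded

section Existence

theorem hasDerivWithinAt_integral_Ici {E : Type*} [NormedAddCommGroup E] [NormedSpace ℝ E]
    [CompleteSpace E] {g : ℝ → E} (hg : ContinuousOn g (Ici 0)) {t : ℝ} (ht : 0 ≤ t) :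
    HasDerivWithinAt (fun u => ∫ s in (0 : ℝ)..u, g s) (g t) (Ici 0) t := by
  have hc : Continuous fun s => g (max s 0) :=
    hg.comp_continuous (by fun_prop) fun s => mem_Ici.2 (le_max_right _ _)
  have h := (intervalIntegral.integral_hasDerivAt_right (hc.intervalIntegrable 0 t)
    hc.stronglyMeasurable.stronglyMeasurableAtFilter hc.continuousAt).hasDerivWithinAt (s := Ici 0)
  simp only [max_eq_left ht] at h
  have e : ∀ u ∈ Ici (0 : ℝ), ∫ s in (0 : ℝ)..u, g s = ∫ s in (0 : ℝ)..u, g (max s 0) :=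
    fun u hu => intervalIntegral_congr_Ioo hu fun s hs => by rw [max_eq_left hs.1.le]
  exact h.congr e (e t ht)

theorem locallyLipschitzOn_of_hasDerivAt {E : Type*} [NormedAddCommGroup E] [NormedSpace ℝ E]
    {f f' : ℝ → E} {S : Set ℝ} (hS : IsOpen S) (hd : ∀ t ∈ S, HasDerivAt f (f' t) t)
    (hc : ∀ t ∈ S, ContinuousAt f' t) : LocallyLipschitzOn S f := by
  intro t ht
  obtain ⟨K, s, hs, hK⟩ := (hasStrictDerivAt_of_hasDerivAt_of_continuousAt
    (Filter.eventually_of_mem (hS.mem_nhds ht) hd) (hc t ht)).hasStrictFDerivAt.exists_lipschitzOnWith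
  exact ⟨K, s, mem_nhdsWithin_of_mem_nhds hs, hK⟩

variable {H : Type*} [NormedAddCommGroup H] [InnerProductSpace ℂ H]

theorem ContinuousOn.op_apply {X : ℝ → H →L[ℂ] H} {S : Set ℝ} {M : ℝ}
    (hM : ∀ t ∈ S, ‖X t‖ ≤ M) (hX : ∀ φ, ContinuousOn (fun t => X t φ) S) {u : ℝ → H}
    (hu : ContinuousOn u S) : ContinuousOn (fun t => X t (u t)) S := by
  intro t ht
  have h1 : Filter.Tendsto (fun s => X s (u s) - X s (u t)) (𝓝[S] t) (𝓝 0) := by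
    have h2 : Filter.Tendsto (fun s => M * ‖u s - u t‖) (𝓝[S] t) (𝓝 0) := by
      have := (tendsto_iff_norm_sub_tendsto_zero.1 (hu t ht)).const_mul M
      simpa using this
    refine squeeze_zero_norm' ?_ h2
    filter_upwards [self_mem_nhdsWithin] with s hs
    rw [← map_sub]
    exact (X s).le_of_opNorm_le (hM s hs) _
  have h2 := h1.add (hX (u t) t ht)
  simpa [ContinuousWithinAt] using h2

variable [CompleteSpace H]

theorem accumulated_eq_memory {G : (H →L[ℂ] H) → H →L[ℂ] H} {ρ : ℝ → ℝ} {W : ℝ → H →L[ℂ] H}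
    (hW : ∀ t, 0 ≤ t → ‖W t‖ ≤ 1) {t : ℝ} (ht : 0 ≤ t) :
    accumulated G ρ W t = memory G ρ W t :=
  intervalIntegral_congr_Ioo ht fun s hs => by rw [truncate_of_norm_le_one (hW s hs.1.le)]

theorem locallyLipschitzOn_accumulated {G : (H →L[ℂ] H) → H →L[ℂ] H} {c : ℝ}
    (hG : LipschitzOnUnitBall G c) {ρ : ℝ → ℝ} (hρ : Continuous ρ) {W : ℝ → H →L[ℂ] H}
    (hc : ContinuousOn W (Ioi 0)) (hW : ∀ t, 0 ≤ t → ‖W t‖ ≤ 1) :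
    LocallyLipschitzOn (Ici 0) (accumulated G ρ W) := by
  intro t ht
  obtain ⟨L, hL0, hL⟩ := hG.exists_norm_memory_sub_le hρ hc (t + 1)
  refine ⟨Real.toNNReal L, Icc 0 (t + 1), ?_, ?_⟩
  · rw [← Ici_inter_Iic]
    exact inter_mem_nhdsWithin _ (Iic_mem_nhds (by linarith))
  · refine LipschitzOnWith.of_dist_le_mul fun x hx y hy => ?_
    rw [Real.coe_toNNReal _ hL0, dist_eq_norm, Real.dist_eq, accumulated_eq_memory hW hx.1,
      accumulated_eq_memory hW hy.1]
    exact hL y hy x hx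

variable {A : H →ₗ.[ℂ] H} {μ : ℝ} {R : H →L[ℂ] H} {Δ W W' : ℝ → H →L[ℂ] H}

theorem IsEvolution.exists_apply_eq (hE : IsEvolution R Δ W W') (hR : IsShiftedResolvent A μ R)
    {t : ℝ} (ht : 0 < t) (x : H) : ∃ h : W t x ∈ A.domain,
      A ⟨W t x, h⟩ = -((2⁻¹ : ℝ) • W' t x) - Δ t (W t x) - μ • W t x := by
  have h1 : R (W' t x) = -((2 : ℝ) • (W t x - R (W t x))) - (2 : ℝ) • R (Δ t (W t x)) := by
    have := congrArg (fun X : H →L[ℂ] H => X x) (hE.mul_deriv t ht)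
    simpa using this
  have h2 : R (W t x - (2⁻¹ : ℝ) • W' t x - Δ t (W t x)) = W t x := by
    have h3 : R ((2⁻¹ : ℝ) • W' t x) = (2⁻¹ : ℝ) • R (W' t x) := R.map_smul_of_tower _ _
    rw [map_sub, map_sub, h3, h1]
    module
  obtain ⟨h, h4⟩ := hR.apply_eq (W t x - (2⁻¹ : ℝ) • W' t x - Δ t (W t x))
  simp only [h2] at h4
  rw [h2] at h
  refine ⟨h, h4.trans ?_⟩
  module

theorem IsEvolution.star_apply_eq (hE : IsEvolution R Δ W W') (hR : IsShiftedResolvent A μ R)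
    {t : ℝ} (ht : 0 < t) (hΔ : IsSelfAdjoint (Δ t)) (η : A.domain) :
    star (W t) (Δ t η + A η) = -((2⁻¹ : ℝ) • star (W' t) (η : H)) - μ • star (W t) (η : H) := by
  have h0 := congrArg star (hE.mul_deriv t ht)
  simp only [star_mul, star_sub, star_neg, star_smul, star_one, star_trivial,
    hR.isSelfAdjoint.star_eq, hΔ.star_eq] at h0
  set z := A η + (μ + 1) • (η : H)
  have e : R z = η := hR.apply_apply η
  have h1 : star (W' t) (R z) = -((2 : ℝ) • star (W t) (z - R z))
      - (2 : ℝ) • star (W t) (Δ t (R z)) := congrArg (fun X : H →L[ℂ] H => X z) h0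
  rw [e] at h1
  have e2 : star (W t) (z - η)
      = star (W t) (A η) + μ • star (W t) (η : H) := by
    have h3 : star (W t) (μ • (η : H)) = μ • star (W t) (η : H) :=
      (star (W t)).map_smul_of_tower _ _
    rw [← h3, ← map_add]
    congr 1
    simp only [z]
    module
  rw [e2] at h1
  rw [h1, map_add]
  module

end Existence

section ExistenceFlow

variable {H : Type*} [NormedAddCommGroup H] [InnerProductSpace ℂ H] [CompleteSpace H]

/-- The flow `D t = e^{4μt} W t D₀ (W t)ᵀ`. -/
noncomputable def ComplexConjugation.flow (C : ComplexConjugation H) (D₀ : H →L[ℂ] H) (μ : ℝ)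
    (W : ℝ → H →L[ℂ] H) (t : ℝ) : H →L[ℂ] H := Real.exp (4 * μ * t) • C.sandwich D₀ (W t)

/-- The formal derivative of `ComplexConjugation.flow`. -/
noncomputable def ComplexConjugation.flowDeriv (C : ComplexConjugation H) (D₀ : H →L[ℂ] H) (μ : ℝ)
    (W W' : ℝ → H →L[ℂ] H) (t : ℝ) : H →L[ℂ] H :=
  Real.exp (4 * μ * t) • (W' t * D₀ * C.boundedTranspose (W t)
      + W t * D₀ * C.boundedTranspose (W' t))
    + (Real.exp (4 * μ * t) * (4 * μ)) • C.sandwich D₀ (W t)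

variable {C : ComplexConjugation H} {D₀ : H →L[ℂ] H} {A : H →ₗ.[ℂ] H} {μ : ℝ} {R : H →L[ℂ] H}
  {Δ W W' : ℝ → H →L[ℂ] H}

theorem smul_gram_eq (t : ℝ) : (16 * Real.exp (8 * μ * t)) • C.gram D₀ (W t)
    = (16 : ℝ) • (C.flow D₀ μ W t * star (C.flow D₀ μ W t)) := by
  rw [ComplexConjugation.flow, star_smul, star_trivial, smul_mul_smul_comm, ← Real.exp_add,
    smul_smul, ComplexConjugation.gram]
  ring_nf

namespace IsEvolution

theorem hasDerivAt_flow (hE : IsEvolution R Δ W W') {t : ℝ} (ht : 0 < t) :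
    HasDerivAt (C.flow D₀ μ W) (C.flowDeriv D₀ μ W W' t) t := by
  have h1 := hE.hasDerivAt t ht
  have h2 : HasDerivAt (fun s => C.boundedTranspose (W s)) (C.boundedTranspose (W' t)) t :=
    C.transposeCLM.hasFDerivAt.comp_hasDerivAt t h1
  have h3 : HasDerivAt (fun s => Real.exp (4 * μ * s)) (Real.exp (4 * μ * t) * (4 * μ)) t := by
    simpa using ((hasDerivAt_id t).const_mul (4 * μ)).exp
  exact h3.smul ((h1.mul_const D₀).mul h2)

theorem continuousAt_flowDeriv (hE : IsEvolution R Δ W W') {t : ℝ} (ht : 0 < t) :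
    ContinuousAt (C.flowDeriv D₀ μ W W') t := by
  have h1 := (hE.hasDerivAt t ht).continuousAt
  have h2 := hE.continuousAt_deriv t ht
  have h3 : ContinuousAt (fun s => C.boundedTranspose (W s)) t :=
    C.transposeCLM.continuous.continuousAt.comp h1
  have h4 : ContinuousAt (fun s => C.boundedTranspose (W' s)) t :=
    C.transposeCLM.continuous.continuousAt.comp h2
  have h5 : ContinuousAt (fun s : ℝ => Real.exp (4 * μ * s)) t := by fun_prop
  exact (h5.smul (((h2.mul continuousAt_const).mul h3).add
    ((h1.mul continuousAt_const).mul h4))).add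
    ((h5.mul continuousAt_const).smul ((h1.mul continuousAt_const).mul h3))

theorem continuousOn_flow_apply (hE : IsEvolution R Δ W W') {v : ℝ → H}
    (hv : ContinuousOn v (Ici 0)) : ContinuousOn (fun t => C.flow D₀ μ W t (v t)) (Ici 0) := by
  have h1 : ContinuousOn (fun t => star (W t) (C.toFun (v t))) (Ici 0) :=
    ContinuousOn.op_apply (fun t ht => (norm_star (W t)).trans_le (hE.norm_le t ht)) hE.strong_star
      (C.continuous.comp_continuousOn hv)
  have h2 := ContinuousOn.op_apply (fun t ht => hE.norm_le t ht) hE.strong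
    (D₀.continuous.comp_continuousOn (C.continuous.comp_continuousOn h1))
  have h3 : Continuous fun s : ℝ => Real.exp (4 * μ * s) := by fun_prop
  exact h3.continuousOn.smul h2

theorem continuousOn_star_flow_apply (hE : IsEvolution R Δ W W') (φ : H) :
    ContinuousOn (fun t => star (C.flow D₀ μ W t) φ) (Ici 0) := by
  have h2 := ContinuousOn.op_apply (fun t ht => hE.norm_le t ht) hE.strong
    (C.continuous.comp_continuousOn ((star D₀).continuous.comp_continuousOn (hE.strong_star φ)))
  have h3 : Continuous fun s : ℝ => Real.exp (4 * μ * s) := by fun_prop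
  refine (h3.continuousOn.smul (C.continuous.comp_continuousOn h2)).congr fun t ht => ?_
  rw [ComplexConjugation.flow, star_smul, star_trivial, ComplexConjugation.sandwich, star_mul,
    star_mul]
  exact congrArg (Real.exp (4 * μ * t) • ·) (C.adjoint_boundedTranspose_apply (W t) _)

theorem flow_mem_domain (hE : IsEvolution R Δ W W') (hR : IsShiftedResolvent A μ R) {t : ℝ}
    (ht : 0 < t) (φ : H) : C.flow D₀ μ W t φ ∈ A.domain := by
  obtain ⟨h, -⟩ := hE.exists_apply_eq hR ht (D₀ (C.boundedTranspose (W t) φ))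
  have := A.domain.smul_mem ((Real.exp (4 * μ * t) : ℝ) : ℂ) h
  rwa [Complex.coe_smul] at this

theorem flow_equation (hE : IsEvolution R Δ W W') (hA : IsSelfAdjoint A)
    (hR : IsShiftedResolvent A μ R) {t : ℝ} (ht : 0 < t) (hΔ : IsSelfAdjoint (Δ t)) {φ : H}
    (hφ : φ ∈ (C.transpose A).domain) :
    ∃ (h₁ : C.flow D₀ μ W t φ ∈ (addBounded (Δ t) A).domain)
      (h₂ : φ ∈ (C.transpose (addBounded (Δ t) A)).domain),
      (-2 : ℝ) • (addBounded (Δ t) A ⟨C.flow D₀ μ W t φ, h₁⟩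
          + C.flow D₀ μ W t (C.transpose (addBounded (Δ t) A) ⟨φ, h₂⟩))
        = C.flowDeriv D₀ μ W W' t φ := by
  have hφ' := (mem_domain_transpose C hA).1 hφ
  obtain ⟨h₂, e₂⟩ := exists_transpose_addBounded_eq C hA (Δ t) hφ'
  have hd : C.flow D₀ μ W t φ ∈ A.domain := hE.flow_mem_domain hR ht φ
  have hd' : C.flow D₀ μ W t φ ∈ (addBounded (Δ t) A).domain := hd
  refine ⟨hd', h₂, ?_⟩
  set ψ := C.boundedTranspose (W t) φ with hψ
  set c := Real.exp (4 * μ * t) with hc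
  have hflow : ∀ f, C.flow D₀ μ W t f = c • W t (D₀ (C.boundedTranspose (W t) f)) := fun f => rfl
  have e₁ : addBounded (Δ t) A ⟨C.flow D₀ μ W t φ, hd'⟩
      = c • (-((2⁻¹ : ℝ) • W' t (D₀ ψ)) - μ • W t (D₀ ψ)) := by
    obtain ⟨h, e⟩ := hE.exists_apply_eq hR ht (D₀ ψ)
    rw [addBounded_apply (Δ t) hd' hd]
    have h3 : (⟨C.flow D₀ μ W t φ, hd⟩ : A.domain)
        = (c : ℂ) • ⟨W t (D₀ ψ), h⟩ := Subtype.ext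
      ((hflow φ).trans (Complex.coe_smul c _).symm)
    have h4 : Δ t (C.flow D₀ μ W t φ) = c • Δ t (W t (D₀ ψ)) := by
      rw [hflow]; exact (Δ t).map_smul_of_tower _ _
    rw [h3, LinearPMap.map_smul, e, Complex.coe_smul, h4, ← smul_add]
    congr 1
    abel
  have e₃ : C.boundedTranspose (W t) (C.boundedTranspose (Δ t) φ + C.toFun (A ⟨C.toFun φ, hφ'⟩))
      = -((2⁻¹ : ℝ) • C.boundedTranspose (W' t) φ) - μ • ψ := by
    have h3 := hE.star_apply_eq hR ht hΔ ⟨C.toFun φ, hφ'⟩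
    have h4 : C.boundedTranspose (Δ t) φ = C.toFun (Δ t (C.toFun φ)) := by
      rw [C.boundedTranspose_apply, ← ContinuousLinearMap.star_eq_adjoint, hΔ.star_eq]
    rw [C.boundedTranspose_apply, map_add, h4, C.involutive, C.involutive,
      ← ContinuousLinearMap.star_eq_adjoint, h3, map_sub, map_neg, C.map_real_smul,
      C.map_real_smul]
    rfl
  have e₄ : W t (D₀ (-((2⁻¹ : ℝ) • C.boundedTranspose (W' t) φ) - μ • ψ))
      = -((2⁻¹ : ℝ) • W t (D₀ (C.boundedTranspose (W' t) φ))) - μ • W t (D₀ ψ) := by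
    have h5 : ∀ (r : ℝ) (x : H), W t (D₀ (r • x)) = r • W t (D₀ x) := fun r x => by
      rw [D₀.map_smul_of_tower]; exact (W t).map_smul_of_tower _ _
    rw [map_sub, map_sub, map_neg, map_neg, h5, h5]
  have e₅ : C.flowDeriv D₀ μ W W' t φ = c • (W' t (D₀ ψ) + W t (D₀ (C.boundedTranspose (W' t) φ)))
      + (c * (4 * μ)) • W t (D₀ ψ) := rfl
  rw [e₁, e₂, hflow, e₃, e₄, e₅]
  module

end IsEvolution

theorem exists_isFlowSolution (C : ComplexConjugation H) (hA : IsSelfAdjoint A)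
    (hμ : LowerBoundedBy A (-μ)) (D₀ : H →L[ℂ] H) : ∃ Δ D : ℝ → H →L[ℂ] H,
      IsFlowSolution C A D₀ Δ D ∧ (∀ t, 0 ≤ t → (Δ t).IsPositive) ∧
      LocallyLipschitzOn (Ici 0) Δ ∧ LocallyLipschitzOn (Ioi 0) D ∧
      ∀ t, 0 < t → ∀ φ, D t φ ∈ A.domain := by
  obtain ⟨R, hR⟩ := exists_isShiftedResolvent hA hμ
  set ρ : ℝ → ℝ := fun s => 16 * Real.exp (8 * μ * s) with hρ
  have hρc : Continuous ρ := by fun_prop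
  have hG := C.lipschitzOnUnitBall_gram D₀
  obtain ⟨W, W', hE, hpos⟩ := exists_isEvolution hR.spectrum_subset hR.isSelfAdjoint
    (hR.denseRange hA) (fun _ => hR.eq_zero) hR.norm_sq_le hG
    (fun x => mul_star_self_nonneg (C.sandwich D₀ x)) hρc (fun s => by positivity)
  set Δ := accumulated (C.gram D₀) ρ W with hΔ
  have hWc : ContinuousOn W (Ioi 0) := fun t ht =>
    (hE.hasDerivAt t ht).continuousAt.continuousWithinAt
  have hLip := locallyLipschitzOn_accumulated hG hρc hWc hE.norm_le
  have hΔpos : ∀ t, 0 ≤ t → (Δ t).IsPositive := fun t ht =>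
    (ContinuousLinearMap.nonneg_iff_isPositive _).1 (hpos t ht)
  refine ⟨Δ, C.flow D₀ μ W, ⟨?_, ?_, ?_, ?_, ?_, ?_⟩, hΔpos, hLip,
    locallyLipschitzOn_of_hasDerivAt isOpen_Ioi (fun t ht => hE.hasDerivAt_flow ht)
      fun t ht => hE.continuousAt_flowDeriv ht, fun t ht φ => hE.flow_mem_domain hR ht φ⟩
  · exact fun φ => (ContinuousLinearMap.apply ℂ H φ).continuous.comp_continuousOn hLip.continuousOn
  · exact fun φ => hE.continuousOn_flow_apply continuousOn_const
  · exact intervalIntegral.integral_same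
  · have h1 : C.boundedTranspose (1 : H →L[ℂ] H) = 1 := by
      ext f
      rw [C.boundedTranspose_apply, ← ContinuousLinearMap.star_eq_adjoint, star_one]
      exact C.involutive f
    simp [ComplexConjugation.flow, ComplexConjugation.sandwich, hE.zero, h1]
  · intro t ht φ
    have hg : ContinuousOn (fun s => (16 : ℝ) • C.flow D₀ μ W s (star (C.flow D₀ μ W s) φ))
        (Ici 0) := (hE.continuousOn_flow_apply (hE.continuousOn_star_flow_apply φ)).const_smul _
    refine (hasDerivWithinAt_integral_Ici hg ht).congr_of_mem (fun u hu => ?_) ht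
    have hi : IntervalIntegrable (fun s => ρ s • C.gram D₀ (W s)) volume 0 u := by
      refine intervalIntegrable_of_continuousOn_of_norm_le hu
        (ContinuousOn.congr ((hG.continuousOn_integrand hρc hWc).mono fun s hs => hs.1)
          fun s hs => ?_)
        (g := fun s => ρ s * (4 * ‖D₀‖ ^ 2))
        ((hρc.mul continuous_const).intervalIntegrable _ _) fun s hs => ?_
      · rw [truncate_of_norm_le_one (hE.norm_le s hs.1.le)]
      · rw [norm_smul, Real.norm_of_nonneg (by positivity)]
        gcongr
        exact hG.norm_le _ (hE.norm_le s hs.1.le)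
    have := ((ContinuousLinearMap.apply ℂ H φ).restrictScalars ℝ).intervalIntegral_comp_comm hi
    refine this.symm.trans (intervalIntegral.integral_congr fun s _ => ?_)
    exact congrArg (fun X : H →L[ℂ] H => X φ) (smul_gram_eq s)
  · intro t ht φ hφ
    obtain ⟨h₁, h₂, e⟩ := hE.flow_equation hA hR ht (hΔpos t ht.le).isSelfAdjoint hφ (D₀ := D₀)
    exact ⟨h₁, h₂, e ▸ (hE.hasDerivAt_flow ht).op_apply_const φ⟩

end ExistenceFlow

section Uniqueness

theorem norm_image_sub_le_of_hasDerivAt_Ioo {E : Type*} [NormedAddCommGroup E] [NormedSpace ℝ E]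
    {f f' : ℝ → E} {B B' : ℝ → ℝ} {a b : ℝ} (hab : a < b) (hf : ContinuousOn f (Icc a b))
    (hd : ∀ s ∈ Ioo a b, HasDerivAt f (f' s) s) (hB : ∀ s, HasDerivAt B (B' s) s)
    (h : ∀ s ∈ Ioo a b, ‖f' s‖ ≤ B' s) : ‖f b - f a‖ ≤ B b - B a := by
  have hε : ∀ ε ∈ Ioo a b, ‖f b - f ε‖ ≤ B b - B ε := fun ε hε => by
    refine image_norm_le_of_norm_deriv_right_le_deriv_boundary (f := fun s => f s - f ε)
      (f' := f') (B := fun s => B s - B ε) (B' := B') (a := ε) (b := b) ?_ (fun s hs => ?_)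
      (by simp) (fun s => (hB s).sub_const _) (fun s hs => h s ⟨hε.1.trans_le hs.1, hs.2⟩)
      ⟨hε.2.le, le_rfl⟩
    · exact (hf.mono (Icc_subset_Icc_left hε.1.le)).sub continuousOn_const
    · exact ((hd s ⟨hε.1.trans_le hs.1, hs.2⟩).sub_const _).hasDerivWithinAt
  have h1 : Filter.Tendsto (fun ε => ‖f b - f ε‖) (𝓝[Ioo a b] a) (𝓝 ‖f b - f a‖) :=
    (tendsto_const_nhds.sub ((hf a ⟨le_rfl, hab.le⟩).mono Ioo_subset_Icc_self)).norm
  have h2 : Filter.Tendsto (fun ε => B b - B ε) (𝓝[Ioo a b] a) (𝓝 (B b - B a)) :=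
    tendsto_const_nhds.sub ((hB a).continuousAt.continuousWithinAt)
  have : (𝓝[Ioo a b] a).NeBot := by
    rw [nhdsWithin_Ioo_eq_nhdsGT hab]; infer_instance
  exact le_of_tendsto_of_tendsto h1 h2 (Filter.eventually_of_mem self_mem_nhdsWithin hε)

variable {H : Type*} [NormedAddCommGroup H] [InnerProductSpace ℂ H]

theorem HasDerivAt.strong_apply {X : ℝ → H →L[ℂ] H} {u : ℝ → H} {d u' : H} {t M : ℝ}
    (hM : ∀ᶠ s in 𝓝 t, ‖X s‖ ≤ M) (hc : ContinuousAt (fun s => X s u') t)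
    (hX : HasDerivAt (fun s => X s (u t)) d t) (hu : HasDerivAt u u' t) :
    HasDerivAt (fun s => X s (u s)) (d + X t u') t := by
  have h2 : HasDerivAt (fun s => X s (u s - u t)) (X t u') t := by
    rw [hasDerivAt_iff_isLittleO] at hu ⊢
    have e : (fun s => X s (u s - u t) - X t (u t - u t) - (s - t) • X t u')
        = fun s => X s (u s - u t - (s - t) • u') + (s - t) • (X s u' - X t u') := by
      funext s
      have h3 : X s ((s - t) • u') = (s - t) • X s u' := (X s).map_smul_of_tower _ _
      rw [map_sub (X s) (u s - u t), h3, sub_self, map_zero]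
      module
    rw [e]
    refine Asymptotics.IsLittleO.add ?_ ?_
    · refine Asymptotics.IsBigO.trans_isLittleO (Asymptotics.IsBigO.of_bound M ?_) hu
      filter_upwards [hM] with s hs using (X s).le_of_opNorm_le hs _
    · have h4 : (fun s => X s u' - X t u') =o[𝓝 t] fun _ => (1 : ℝ) := by
        rw [Asymptotics.isLittleO_one_iff]
        exact tendsto_sub_nhds_zero_iff.2 hc
      simpa using (Asymptotics.isBigO_refl (fun s => s - t) (𝓝 t)).smul_isLittleO h4
  refine (hX.add h2).congr_of_eventuallyEq (Filter.Eventually.of_forall fun s => ?_)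
  simp

variable [CompleteSpace H]

theorem StronglyContinuous.exists_norm_le {X : ℝ → H →L[ℂ] H} (hX : StronglyContinuous X) (T : ℝ) :
    ∃ M, ∀ s ∈ Icc 0 T, ‖X s‖ ≤ M := by
  obtain ⟨M, hM⟩ := banach_steinhaus (g := fun s : Icc (0 : ℝ) T => X s) fun φ => by
    obtain ⟨c, hc⟩ := (isCompact_Icc (a := (0 : ℝ)) (b := T)).exists_bound_of_continuousOn
      ((hX φ).mono fun _ hs => hs.1)
    exact ⟨c, fun s => hc s s.2⟩
  exact ⟨M, fun s hs => hM ⟨s, hs⟩⟩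

variable {C : ComplexConjugation H} {D₀ : H →L[ℂ] H} {A : H →ₗ.[ℂ] H} {μ : ℝ} {R : H →L[ℂ] H}
  {Δ D : ℝ → H →L[ℂ] H}

namespace IsShiftedResolvent

theorem isHeatSemigroup (hR : IsShiftedResolvent A μ R) :
    IsHeatSemigroup R (heat R) (heatOp R 1) :=
  isHeatSemigroup_heat hR.spectrum_subset hR.isSelfAdjoint fun x hx => by
    ext φ
    exact hR.eq_zero (congrArg (fun X : H →L[ℂ] H => X φ) hx)

theorem norm_heat_le (hR : IsShiftedResolvent A μ R) {t : ℝ} (ht : 0 ≤ t) : ‖heat R t‖ ≤ 1 := by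
  rcases ht.eq_or_lt with rfl | h
  · rw [hR.isHeatSemigroup.zero]; exact ContinuousLinearMap.norm_id_le
  · exact hR.isHeatSemigroup.norm_le t h

theorem exists_apply_heat (hR : IsShiftedResolvent A μ R) {t : ℝ} (ht : 0 < t) (x : H) :
    ∃ h : heat R t x ∈ A.domain, A ⟨heat R t x, h⟩ = heatOp R 1 t x - μ • heat R t x := by
  have h1 : R (heatOp R 1 t x) = heat R t x - R (heat R t x) :=
    congrArg (fun X : H →L[ℂ] H => X x) (hR.isHeatSemigroup.mul_gen t ht)
  have h2 : R (heat R t x + heatOp R 1 t x) = heat R t x := by rw [map_add, h1]; abel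
  obtain ⟨h, h3⟩ := hR.apply_eq (heat R t x + heatOp R 1 t x)
  simp only [h2] at h3
  rw [h2] at h
  refine ⟨h, h3.trans ?_⟩
  module

theorem heatOp_apply (hR : IsShiftedResolvent A μ R) {t : ℝ} (ht : 0 < t) (x : A.domain) :
    heatOp R 1 t (x : H) = heat R t (A x) + μ • heat R t (x : H) := by
  set z := A x + (μ + 1) • (x : H) with hz
  have e : R z = x := hR.apply_apply x
  have h1 : heatOp R 1 t (R z) = heat R t z - heat R t (R z) := by
    have c1 := commute_heatOp hR.isSelfAdjoint 1 t
    have c2 := commute_heat hR.isSelfAdjoint t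
    have h2 : heatOp R 1 t * R = heat R t - heat R t * R := by
      rw [← c1.eq, hR.isHeatSemigroup.mul_gen t ht, sub_mul, one_mul, c2.eq]
    exact congrArg (fun X : H →L[ℂ] H => X z) h2
  have h3 : heat R t z = heat R t (A x) + (μ + 1) • heat R t (x : H) := by
    rw [hz, map_add]; congr 1; exact (heat R t).map_smul_of_tower _ _
  rw [e, h3] at h1
  rw [h1]
  module

end IsShiftedResolvent

/-- The interpolation `e^{4μ(t-s)} P (t-s) X (P (t-s))ᵀ φ` of Duhamel's formula. -/
noncomputable def ComplexConjugation.duhamel (C : ComplexConjugation H) (R : H →L[ℂ] H) (μ t : ℝ)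
    (X : H →L[ℂ] H) (φ : H) (s : ℝ) : H :=
  Real.exp (4 * μ * (t - s)) • heat R (t - s) (X (C.toFun (heat R (t - s) (C.toFun φ))))

theorem ComplexConjugation.norm_duhamel_le (hR : IsShiftedResolvent A μ R) {t s T : ℝ}
    (hs : s ∈ Icc 0 t) (ht : t ≤ T) (X : H →L[ℂ] H) (φ : H) :
    ‖C.duhamel R μ t X φ s‖ ≤ Real.exp (4 * |μ| * T) * ‖X‖ * ‖φ‖ := by
  have hts : 0 ≤ t - s := sub_nonneg.2 hs.2
  have h1 : ‖C.toFun (heat R (t - s) (C.toFun φ))‖ ≤ ‖φ‖ := by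
    rw [C.norm_map]
    have := (heat R (t - s)).le_of_opNorm_le (hR.norm_heat_le hts) (C.toFun φ)
    rwa [one_mul, C.norm_map] at this
  have h2 := (heat R (t - s)).le_of_opNorm_le (hR.norm_heat_le hts)
    (X (C.toFun (heat R (t - s) (C.toFun φ))))
  have h3 := X.le_opNorm_of_le h1
  have h4 : Real.exp (4 * μ * (t - s)) ≤ Real.exp (4 * |μ| * T) := by
    apply Real.exp_le_exp.2
    have h5 : μ * (t - s) ≤ |μ| * T :=
      mul_le_mul (le_abs_self μ) (by linarith [hs.1]) hts (abs_nonneg μ)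
    linarith
  rw [ComplexConjugation.duhamel, norm_smul, Real.norm_of_nonneg (Real.exp_pos _).le,
    mul_assoc (Real.exp (4 * |μ| * T))]
  rw [one_mul] at h2
  exact mul_le_mul h4 (h2.trans h3) (norm_nonneg _) (Real.exp_pos _).le

theorem ComplexConjugation.duhamel_sub (X Y : H →L[ℂ] H) (φ : H) (t s : ℝ) :
    C.duhamel R μ t (X - Y) φ s = C.duhamel R μ t X φ s - C.duhamel R μ t Y φ s := by
  simp [ComplexConjugation.duhamel, smul_sub]

namespace IsFlowSolution

theorem hasDerivAt_duhamel (hF : IsFlowSolution C A D₀ Δ D) (hA : IsSelfAdjoint A)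
    (hR : IsShiftedResolvent A μ R) {s t : ℝ} (hs : s ∈ Ioo 0 t) (φ : H) :
    HasDerivAt (fun r => C.duhamel R μ t (D r) φ r)
      ((-2 : ℝ) • C.duhamel R μ t (Δ s * D s + D s * C.boundedTranspose (Δ s)) φ s) s := by
  have hts : 0 < t - s := sub_pos.2 hs.2
  have hP : HasDerivAt (fun r => heat R (t - r)) ((2 : ℝ) • heatOp R 1 (t - s)) s := by
    have := (hR.isHeatSemigroup.hasDerivAt (t - s) hts).scomp s ((hasDerivAt_id s).const_sub t)
    simpa [Function.comp_def] using this
  set η := C.toFun φ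
  set y : ℝ → H := fun r => C.toFun (heat R (t - r) η) with hy
  have hyd : HasDerivAt y ((2 : ℝ) • C.toFun (heatOp R 1 (t - s) η)) s := by
    have := C.toCLM.hasFDerivAt.comp_hasDerivAt s (hP.op_apply_const η)
    rw [smul_apply, map_smul] at this
    exact this
  obtain ⟨hmem, hAy⟩ := hR.exists_apply_heat hts η
  have hCy : C.toFun (y s) = heat R (t - s) η := C.involutive _
  have hCm : C.toFun (y s) ∈ A.domain := hCy ▸ hmem
  obtain ⟨h₁, h₂, hD⟩ := hF.deriv_D s hs.1 (y s) ((mem_domain_transpose C hA).2 hCm)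
  obtain ⟨h₂', e₂⟩ := exists_transpose_addBounded_eq C hA (Δ s) hCm
  have h₁' : D s (y s) ∈ A.domain := h₁
  have e₃ : C.toFun (A ⟨C.toFun (y s), hCm⟩) = C.toFun (heatOp R 1 (t - s) η) - μ • y s := by
    have : (⟨C.toFun (y s), hCm⟩ : A.domain) = ⟨heat R (t - s) η, hmem⟩ := Subtype.ext hCy
    rw [this, hAy, map_sub, C.map_real_smul]
  rw [addBounded_apply (Δ s) h₁ h₁', e₂, e₃] at hD
  obtain ⟨M, hM⟩ := hF.continuous_D.exists_norm_le t
  have hDy := HasDerivAt.strong_apply (M := M) (X := D) (u := y)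
    (Filter.eventually_of_mem (Icc_mem_nhds hs.1 hs.2) hM)
    ((hF.continuous_D _).continuousAt (Ici_mem_nhds hs.1)) hD hyd
  have hPD := hP.op_apply hDy
  have hexp : HasDerivAt (fun r => Real.exp (4 * μ * (t - r)))
      (Real.exp (4 * μ * (t - s)) * (4 * μ * (-1))) s :=
    (((hasDerivAt_id s).const_sub t).const_mul (4 * μ)).exp
  have hG := hexp.smul hPD
  refine hG.congr_deriv ?_
  have e₄ := hR.heatOp_apply hts ⟨D s (y s), h₁'⟩
  have r1 : ∀ (X : H →L[ℂ] H) (c : ℝ) (x : H), X (c • x) = c • X x := fun X c x =>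
    X.map_smul_of_tower c x
  simp only [ComplexConjugation.duhamel, add_apply, smul_apply,
    map_add, map_sub, r1, smul_add, smul_sub] at e₄ ⊢
  simp only [e₄]
  change _ = (-2 : ℝ) • Real.exp (4 * μ * (t - s)) • heat R (t - s) (Δ s (D s (y s)))
    + (-2 : ℝ) • Real.exp (4 * μ * (t - s)) • heat R (t - s) (D s (C.boundedTranspose (Δ s) (y s)))
  module

theorem continuousOn_duhamel (hF : IsFlowSolution C A D₀ Δ D) (hA : IsSelfAdjoint A)
    (hR : IsShiftedResolvent A μ R) (t : ℝ) (φ : H) :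
    ContinuousOn (fun r => C.duhamel R μ t (D r) φ r) (Icc 0 t) := by
  have hP : ∀ ψ, ContinuousOn (fun s => heat R (t - s) ψ) (Icc 0 t) := fun ψ =>
    (continuousOn_heat_apply hR.spectrum_subset hR.isSelfAdjoint (hR.denseRange hA) ψ).comp
      (by fun_prop) fun s hs => sub_nonneg.2 hs.2
  obtain ⟨M, hM⟩ := hF.continuous_D.exists_norm_le t
  have h1 := ContinuousOn.op_apply hM (fun ψ => (hF.continuous_D ψ).mono Icc_subset_Ici_self)
    (C.continuous.comp_continuousOn (hP (C.toFun φ)))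
  have h2 := ContinuousOn.op_apply (fun s hs => hR.norm_heat_le (sub_nonneg.2 hs.2)) hP h1
  have h3 : Continuous fun s : ℝ => Real.exp (4 * μ * (t - s)) := by fun_prop
  exact h3.continuousOn.smul h2

variable {Δ' D' : ℝ → H →L[ℂ] H}

theorem norm_sub_le_step (hF : IsFlowSolution C A D₀ Δ D) (hF' : IsFlowSolution C A D₀ Δ' D')
    (hA : IsSelfAdjoint A) (hR : IsShiftedResolvent A μ R) {T M b : ℝ} {n : ℕ} (hM0 : 0 ≤ M)
    (hb : 0 ≤ b) (hM : ∀ s ∈ Icc 0 T, ‖Δ s‖ ≤ M ∧ ‖D s‖ ≤ M ∧ ‖Δ' s‖ ≤ M ∧ ‖D' s‖ ≤ M)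
    (h : ∀ s ∈ Ioc 0 T, ‖Δ s - Δ' s‖ ≤ b * s ^ n ∧ ‖D s - D' s‖ ≤ b * s ^ n) {t : ℝ}
    (ht : t ∈ Ioc 0 T) :
    ‖Δ t - Δ' t‖ ≤ 32 * M * Real.exp (4 * |μ| * T) * b / (n + 1) * t ^ (n + 1) ∧
      ‖D t - D' t‖ ≤ 32 * M * Real.exp (4 * |μ| * T) * b / (n + 1) * t ^ (n + 1) := by
  have hexp : 1 ≤ Real.exp (4 * |μ| * T) := Real.one_le_exp (by
    have := ht.1.le.trans ht.2; positivity)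
  have hn : (0 : ℝ) < n + 1 := by positivity
  have hB : ∀ c s : ℝ, HasDerivAt (fun s : ℝ => c / (n + 1) * s ^ (n + 1)) (c * s ^ n) s := by
    intro c s
    refine ((hasDerivAt_pow (n + 1) s).const_mul (c / (n + 1))).congr_deriv ?_
    push_cast
    field_simp
  have ht0 := ht.1
  constructor
  · refine ContinuousLinearMap.opNorm_le_bound _ (by positivity) fun φ => ?_
    have key := norm_image_sub_le_of_hasDerivAt_Ioo (f := fun s => Δ s φ - Δ' s φ)
      (f' := fun s => (16 : ℝ) • D s (ContinuousLinearMap.adjoint (D s) φ)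
        - (16 : ℝ) • D' s (ContinuousLinearMap.adjoint (D' s) φ)) (a := 0) (b := t)
      (B := fun s => 32 * M * b * ‖φ‖ / (n + 1) * s ^ (n + 1))
      (B' := fun s => 32 * M * b * ‖φ‖ * s ^ n) ht0
      (((hF.continuous_delta φ).sub (hF'.continuous_delta φ)).mono Icc_subset_Ici_self)
      (fun s hs => ((hF.deriv_delta s hs.1.le φ).hasDerivAt (Ici_mem_nhds hs.1)).sub
        ((hF'.deriv_delta s hs.1.le φ).hasDerivAt (Ici_mem_nhds hs.1)))
      (hB _) (fun s hs => ?_)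
    · simp only [hF.delta_zero, hF'.delta_zero, sub_self, sub_zero, zero_pow (Nat.succ_ne_zero n),
        mul_zero] at key
      rw [sub_apply]
      refine key.trans ?_
      have : M * 1 * b ≤ M * Real.exp (4 * |μ| * T) * b := by gcongr
      calc 32 * M * b * ‖φ‖ / (n + 1) * t ^ (n + 1)
          = 32 * (M * 1 * b) / (n + 1) * t ^ (n + 1) * ‖φ‖ := by ring
        _ ≤ 32 * (M * Real.exp (4 * |μ| * T) * b) / (n + 1) * t ^ (n + 1) * ‖φ‖ := by gcongr
        _ = _ := by ring
    · obtain ⟨-, m1, -, m2⟩ := hM s ⟨hs.1.le, hs.2.le.trans ht.2⟩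
      obtain ⟨-, d1⟩ := h s ⟨hs.1, hs.2.le.trans ht.2⟩
      have hs0 := hs.1
      have e : D s (ContinuousLinearMap.adjoint (D s) φ)
          - D' s (ContinuousLinearMap.adjoint (D' s) φ)
          = ((D s - D' s) * star (D s) + D' s * star (D s - D' s)) φ := by
        simp only [star_sub, ContinuousLinearMap.star_eq_adjoint, mul_sub, sub_mul]
        simp
      have h1 : ‖(D s - D' s) * star (D s)‖ ≤ b * s ^ n * M :=
        (norm_mul_le _ _).trans (mul_le_mul d1 ((norm_star _).trans_le m1) (norm_nonneg _)
          (by positivity))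
      have h2 : ‖D' s * star (D s - D' s)‖ ≤ M * (b * s ^ n) :=
        (norm_mul_le _ _).trans (mul_le_mul m2 ((norm_star _).trans_le d1) (norm_nonneg _) hM0)
      have h3 := ContinuousLinearMap.le_of_opNorm_le _ ((norm_add_le _ _).trans (add_le_add h1 h2)) φ
      rw [← smul_sub, e, norm_smul, Real.norm_of_nonneg (by norm_num)]
      linarith
  · refine ContinuousLinearMap.opNorm_le_bound _ (by positivity) fun φ => ?_
    set c := Real.exp (4 * |μ| * T) with hc
    have key := norm_image_sub_le_of_hasDerivAt_Ioo
      (f := fun s => C.duhamel R μ t (D s) φ s - C.duhamel R μ t (D' s) φ s)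
      (f' := fun s => (-2 : ℝ) • C.duhamel R μ t (Δ s * D s + D s * C.boundedTranspose (Δ s)) φ s
        - (-2 : ℝ) • C.duhamel R μ t (Δ' s * D' s + D' s * C.boundedTranspose (Δ' s)) φ s)
      (a := 0) (b := t)
      (B := fun s => 32 * M * c * b * ‖φ‖ / (n + 1) * s ^ (n + 1))
      (B' := fun s => 32 * M * c * b * ‖φ‖ * s ^ n) ht0
      ((hF.continuousOn_duhamel hA hR t φ).sub (hF'.continuousOn_duhamel hA hR t φ))
      (fun s hs => (hF.hasDerivAt_duhamel hA hR hs φ).sub (hF'.hasDerivAt_duhamel hA hR hs φ))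
      (hB _) (fun s hs => ?_)
    · have e0 : ∀ X : H →L[ℂ] H, C.duhamel R μ t X φ t = X φ := fun X => by
        simp [ComplexConjugation.duhamel, hR.isHeatSemigroup.zero, C.involutive]
      simp only [hF.D_zero, hF'.D_zero, sub_self, sub_zero, zero_pow (Nat.succ_ne_zero n),
        mul_zero, e0] at key
      rw [sub_apply]
      refine key.trans (le_of_eq ?_)
      ring
    · have hsT : s ≤ T := hs.2.le.trans ht.2
      obtain ⟨m1, m2, m3, m4⟩ := hM s ⟨hs.1.le, hsT⟩
      obtain ⟨d1, d2⟩ := h s ⟨hs.1, hsT⟩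
      have hs0 := hs.1
      have e : Δ s * D s + D s * C.boundedTranspose (Δ s)
          - (Δ' s * D' s + D' s * C.boundedTranspose (Δ' s))
          = (Δ s - Δ' s) * D s + Δ' s * (D s - D' s)
            + ((D s - D' s) * C.boundedTranspose (Δ s)
              + D' s * C.boundedTranspose (Δ s - Δ' s)) := by
        simp only [← C.transposeCLM_apply, map_sub]
        noncomm_ring
      have h1 : ‖(Δ s - Δ' s) * D s‖ ≤ b * s ^ n * M :=
        (norm_mul_le _ _).trans (mul_le_mul d1 m2 (norm_nonneg _) (by positivity))
      have h2 : ‖Δ' s * (D s - D' s)‖ ≤ M * (b * s ^ n) :=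
        (norm_mul_le _ _).trans (mul_le_mul m3 d2 (norm_nonneg _) hM0)
      have h3 : ‖(D s - D' s) * C.boundedTranspose (Δ s)‖ ≤ b * s ^ n * M :=
        (norm_mul_le _ _).trans (mul_le_mul d2 ((C.norm_boundedTranspose_le _).trans m1)
          (norm_nonneg _) (by positivity))
      have h4 : ‖D' s * C.boundedTranspose (Δ s - Δ' s)‖ ≤ M * (b * s ^ n) :=
        (norm_mul_le _ _).trans (mul_le_mul m4 ((C.norm_boundedTranspose_le _).trans d1)
          (norm_nonneg _) hM0)
      have h5 := (norm_add_le _ _).trans (add_le_add ((norm_add_le _ _).trans (add_le_add h1 h2))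
        ((norm_add_le _ _).trans (add_le_add h3 h4)))
      rw [← smul_sub, ← ComplexConjugation.duhamel_sub, norm_smul, e]
      have h6 := ComplexConjugation.norm_duhamel_le (C := C) hR ⟨hs.1.le, hs.2.le⟩ ht.2
        ((Δ s - Δ' s) * D s + Δ' s * (D s - D' s)
            + ((D s - D' s) * C.boundedTranspose (Δ s)
              + D' s * C.boundedTranspose (Δ s - Δ' s))) φ
      have h7 : c * ‖(Δ s - Δ' s) * D s + Δ' s * (D s - D' s)
            + ((D s - D' s) * C.boundedTranspose (Δ s)
              + D' s * C.boundedTranspose (Δ s - Δ' s))‖ * ‖φ‖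
          ≤ c * (b * s ^ n * M + M * (b * s ^ n) + (b * s ^ n * M + M * (b * s ^ n))) * ‖φ‖ := by
        gcongr
      have h8 : 0 ≤ M * c * b * ‖φ‖ * s ^ n := by positivity
      rw [Real.norm_eq_abs, abs_neg, abs_two]
      have h9 : c * (b * s ^ n * M + M * (b * s ^ n) + (b * s ^ n * M + M * (b * s ^ n))) * ‖φ‖
          = 4 * (M * c * b * ‖φ‖ * s ^ n) := by ring
      linarith

theorem unique (hF : IsFlowSolution C A D₀ Δ D) (hF' : IsFlowSolution C A D₀ Δ' D')
    (hA : IsSelfAdjoint A) (hμ : LowerBoundedBy A (-μ)) :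
    EqOn Δ Δ' (Ici 0) ∧ EqOn D D' (Ici 0) := by
  obtain ⟨R, hR⟩ := exists_isShiftedResolvent hA hμ
  have main : ∀ T, 0 < T → Δ T = Δ' T ∧ D T = D' T := by
    intro T hT
    obtain ⟨M1, h1⟩ := hF.continuous_delta.exists_norm_le T
    obtain ⟨M2, h2⟩ := hF.continuous_D.exists_norm_le T
    obtain ⟨M3, h3⟩ := hF'.continuous_delta.exists_norm_le T
    obtain ⟨M4, h4⟩ := hF'.continuous_D.exists_norm_le T
    set M := max (max M1 M2) (max M3 M4)
    have hM : ∀ s ∈ Icc 0 T, ‖Δ s‖ ≤ M ∧ ‖D s‖ ≤ M ∧ ‖Δ' s‖ ≤ M ∧ ‖D' s‖ ≤ M := fun s hs =>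
      ⟨(h1 s hs).trans ((le_max_left _ _).trans (le_max_left _ _)),
        (h2 s hs).trans ((le_max_right _ _).trans (le_max_left _ _)),
        (h3 s hs).trans ((le_max_left _ _).trans (le_max_right _ _)),
        (h4 s hs).trans ((le_max_right _ _).trans (le_max_right _ _))⟩
    have hM0 : 0 ≤ M := (norm_nonneg _).trans (hM 0 ⟨le_rfl, hT.le⟩).1
    set L := 32 * M * Real.exp (4 * |μ| * T)
    have hL : 0 ≤ L := by positivity
    have key : ∀ n : ℕ, ∀ s ∈ Ioc 0 T, ‖Δ s - Δ' s‖ ≤ 2 * M * L ^ n / n.factorial * s ^ n ∧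
        ‖D s - D' s‖ ≤ 2 * M * L ^ n / n.factorial * s ^ n := by
      intro n
      induction n with
      | zero =>
        intro s hs
        obtain ⟨m1, m2, m3, m4⟩ := hM s (Ioc_subset_Icc_self hs)
        simp only [pow_zero, Nat.factorial_zero, Nat.cast_one, div_one, mul_one]
        exact ⟨(norm_sub_le _ _).trans (by linarith), (norm_sub_le _ _).trans (by linarith)⟩
      | succ n ih =>
        intro s hs
        have := norm_sub_le_step hF hF' hA hR hM0 (b := 2 * M * L ^ n / n.factorial)
          (by positivity) hM ih hs
        have e : L * (2 * M * L ^ n / n.factorial) / (n + 1)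
            = 2 * M * L ^ (n + 1) / (n + 1).factorial := by
          rw [Nat.factorial_succ]
          push_cast
          field_simp
          ring
        rwa [e] at this
    have hlim : Filter.Tendsto (fun n : ℕ => 2 * M * L ^ n / n.factorial * T ^ n) Filter.atTop
        (𝓝 0) := by
      have := (FloorSemiring.tendsto_pow_div_factorial_atTop (L * T)).const_mul (2 * M)
      rw [mul_zero] at this
      refine this.congr fun n => ?_
      rw [mul_pow]
      ring
    have hTm : T ∈ Ioc 0 T := ⟨hT, le_rfl⟩
    constructor
    · exact sub_eq_zero.1 (norm_le_zero_iff.1 (ge_of_tendsto' hlim fun n => (key n T hTm).1))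
    · exact sub_eq_zero.1 (norm_le_zero_iff.1 (ge_of_tendsto' hlim fun n => (key n T hTm).2))
  constructor
  · intro t ht
    rcases (mem_Ici.1 ht).eq_or_lt with rfl | h
    · rw [hF.delta_zero, hF'.delta_zero]
    · exact (main t h).1
  · intro t ht
    rcases (mem_Ici.1 ht).eq_or_lt with rfl | h
    · rw [hF.D_zero, hF'.D_zero]
    · exact (main t h).2

end IsFlowSolution

end Uniqueness

end FlowTheory

theorem mainTheorem1 {H : Type*} [NormedAddCommGroup H] [InnerProductSpace ℂ H] [CompleteSpace H]
    [TopologicalSpace.SeparableSpace H] (C : ComplexConjugation H)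
    (Υ₀ : H →ₗ.[ℂ] H) (μ : ℝ) (hΥ₀ : IsSelfAdjoint Υ₀) (hμ : LowerBoundedBy Υ₀ (-μ))
    (D₀ : H →L[ℂ] H) (hD₀ : D₀ ≠ 0) :
    ∃ Δ D : ℝ → H →L[ℂ] H,
      IsFlowSolution C Υ₀ D₀ Δ D ∧
      (∀ Δ' D' : ℝ → H →L[ℂ] H, IsFlowSolution C Υ₀ D₀ Δ' D' →
        EqOn Δ' Δ (Ici 0) ∧ EqOn D' D (Ici 0)) ∧
      ((∀ t : ℝ, 0 ≤ t → (Δ t).IsPositive) ∧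
        ContinuousOn Δ (Ici 0) ∧ LocallyLipschitzOn (Ici 0) Δ) ∧
      (ContinuousOn D (Ioi 0) ∧ LocallyLipschitzOn (Ioi 0) D ∧
        ∀ t : ℝ, 0 < t → ∀ φ : H, D t φ ∈ Υ₀.domain) := by
  obtain ⟨Δ, D, hF, hpos, hΔ, hD, hdom⟩ := exists_isFlowSolution C hΥ₀ hμ D₀
  exact ⟨Δ, D, hF, fun Δ' D' h => h.unique hF hΥ₀ hμ, ⟨hpos, hΔ.continuousOn, hΔ⟩,
    hD.continuousOn, hD, hdom⟩
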